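/- There is an absolute constant $c>0$ such that the following holds. Let $G$ be a finite simple bipartite graph with non-empty vertex set and with vertex classes $A$ and $B$, and let $L$ be a real number and $s$ an integer with $L\ge s\ge 2$. Suppose that $G$ is $(L,s)$-almost-biregular, i.e. that $d_G(v)=s$ for every $v\in B$ and that, writing $d=e(G)/|A|$, where $e(G)$ is the number of edges of $G$, we have $d\ge s$ and $d_G(u)\le Ld$ for every $u\in A$. Then for every integer $r\ge 0$ with $r\le cs/\log_2 L$, $G$ has a (not necessarily induced) subgraph with non-empty vertex set in which every vertex has degree exactly $r$. -/

import Mathlib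

namespace SimpleGraph

/-- The finite graph `G` is a bipartite graph with vertex classes `A` and `B` (which partition the
whole vertex set) and is `(L, s)`-almost-biregular: every vertex of `B` has degree exactly `s` and,
writing `d = e(G) / |A|`, we have `d ≥ s` and every vertex of `A` has degree at most `L * d`. -/
structure IsAlmostBiregular {V : Type*} [Fintype V] (G : SimpleGraph V) [DecidableRel G.Adj]
    (A B : Finset V) (L : ℝ) (s : ℕ) : Prop where
  isBipartiteWith : G.IsBipartiteWith (A : Set V) (B : Set V)
  mem_or_mem : ∀ v : V, v ∈ A ∨ v ∈ B
  degree_right : ∀ v ∈ B, G.degree v = s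
  le_average : (s : ℝ) ≤ (G.edgeFinset.card : ℝ) / (A.card : ℝ)
  degree_left : ∀ u ∈ A, (G.degree u : ℝ) ≤ L * ((G.edgeFinset.card : ℝ) / (A.card : ℝ))

open Classical in
/-- The finite graph `G` contains an `r`-regular subgraph (not necessarily induced or spanning) with
a non-empty vertex set. -/
def HasRegularSubgraph {V : Type*} [Fintype V] (G : SimpleGraph V) (r : ℕ) : Prop :=
  ∃ H : G.Subgraph, H.verts.Nonempty ∧ H.coe.IsRegularOfDegree r

end SimpleGraph

/-! Regular subgraphs are reached through edge weightings with values in [0,1].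
`HasNearRegularWeight` says that the weighted degrees inside some vertex set lie within Λ of T, up
to an average excess η.

A first weighting comes from `exists_balanced_flow`: choose X ⊆ A maximising ∑_y d_X(y)^m / |X|,
with m about 2 log₂ L. Maximality is a Hall condition, so a flow spreads the masses d_X(y)^m evenly
over X. The power m is so large that, despite degrees up to Ld in A, the vertices y with d_X(y) <
s/2 contribute at most a 1/T share. Sampling the remaining y with probability proportional to
d_X(y)^m yields Λ = T/100 with T = s/(2m), which is of order s / log L
(`hasNearRegularWeight_of_density`).

The width Λ is then halved repeatedly (`HasNearRegularWeight.halve`). Vertices are kept with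
probability proportional to their truncated degree and weights are rescaled inversely, which
equalises the expected degrees. The probabilities differ from 1 by O(Λ/T), so the variance of a
degree is O(Λ), not O(T), and the new deviation is far below Λ/2 while Λ is large. The losses in T
form a geometric series, so Λ drops to an absolute constant while T at most halves.

Finally T is a large multiple of r and Λ is bounded, so truncation gives a fractional
(2q-1)-matching of weight more than (q-1)|U|, where q is a prime in (r, 2r]. Integrality of the
bipartite matching polytope makes it a graph, Chevalley–Warning finds a q-regular subgraph
(`exists_regular_of_prime`), and integrality applied to the constant weight r/q on it gives an
r-regular one. -/

/-- The probability that the random subset of `U` containing each `i` independently with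
probability `p i` equals `S`. -/
noncomputable def subsetWeight {ι : Type*} [DecidableEq ι] (U : Finset ι) (p : ι → ℝ)
    (S : Finset ι) : ℝ :=
  (∏ i ∈ S, p i) * ∏ i ∈ U \ S, (1 - p i)

/-! ### Independent random subsets and exponential tail bounds. -/

section RandomSubset

variable {ι : Type*} [DecidableEq ι] {U : Finset ι} {p : ι → ℝ}

lemma subsetWeight_nonneg (h0 : ∀ i ∈ U, 0 ≤ p i) (h1 : ∀ i ∈ U, p i ≤ 1) {S : Finset ι}
    (hS : S ⊆ U) : 0 ≤ subsetWeight U p S :=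
  mul_nonneg (Finset.prod_nonneg fun i hi => h0 i (hS hi))
    (Finset.prod_nonneg fun i hi => sub_nonneg.2 (h1 i (Finset.mem_sdiff.1 hi).1))

/-- Independence: an expectation of a product over coordinates factorises, by expanding the product
of binomials. -/
lemma sum_subsetWeight_mul_prod (a b : ι → ℝ) :
    ∑ S ∈ U.powerset, subsetWeight U p S * ((∏ i ∈ S, a i) * ∏ i ∈ U \ S, b i) =
      ∏ i ∈ U, (p i * a i + (1 - p i) * b i) := by
  rw [Finset.prod_add]
  refine Finset.sum_congr rfl fun S _ => ?_
  simp only [subsetWeight, Finset.prod_mul_distrib]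
  ring

lemma sum_subsetWeight : ∑ S ∈ U.powerset, subsetWeight U p S = 1 := by
  have := sum_subsetWeight_mul_prod (U := U) (p := p) (fun _ => 1) (fun _ => 1)
  simpa using this

lemma sum_subsetWeight_mul_sum (a : ι → ℝ) :
    ∑ S ∈ U.powerset, subsetWeight U p S * ∑ i ∈ S, a i = ∑ i ∈ U, p i * a i := by
  induction U using Finset.induction_on with
  | empty => simp [subsetWeight]
  | insert j U hj ih =>
    rw [Finset.sum_powerset_insert hj, Finset.sum_insert hj, ← ih]
    have h1 : ∀ S ∈ U.powerset, subsetWeight (insert j U) p S = (1 - p j) * subsetWeight U p S := by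
      intro S hS
      have hjS : j ∉ S := fun h => hj (Finset.mem_powerset.1 hS h)
      have : insert j U \ S = insert j (U \ S) := by
        rw [Finset.insert_sdiff_of_notMem _ hjS]
      rw [subsetWeight, this, Finset.prod_insert (by simp [hj]), subsetWeight]
      ring
    have h2 : ∀ S ∈ U.powerset,
        subsetWeight (insert j U) p (insert j S) = p j * subsetWeight U p S := by
      intro S hS
      have hjS : j ∉ S := fun h => hj (Finset.mem_powerset.1 hS h)
      have : insert j U \ insert j S = U \ S := by
        rw [Finset.insert_sdiff_insert, Finset.sdiff_insert_of_notMem hj]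
      rw [subsetWeight, this, Finset.prod_insert hjS, subsetWeight]
      ring
    rw [Finset.sum_congr rfl fun S hS => by rw [h1 S hS],
      Finset.sum_congr (s₁ := U.powerset) (f := fun S => subsetWeight (insert j U) p (insert j S) *
        ∑ i ∈ insert j S, a i) rfl fun S hS => by
        rw [h2 S hS, Finset.sum_insert fun h => hj (Finset.mem_powerset.1 hS h)]]
    have h3 := sum_subsetWeight (U := U) (p := p)
    calc _ = ∑ S ∈ U.powerset, (subsetWeight U p S * ∑ i ∈ S, a i
            + p j * a j * subsetWeight U p S) := by
          rw [← Finset.sum_add_distrib]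
          exact Finset.sum_congr rfl fun S _ => by ring
      _ = _ := by rw [Finset.sum_add_distrib, ← Finset.mul_sum, h3]; ring

/-- The moment generating function of a centred Bernoulli variable. -/
lemma bernoulli_mgf_le {q t : ℝ} (h0 : 0 ≤ q) (h1 : q ≤ 1) (ht : |t| ≤ 1) :
    q * Real.exp (t * (1 - q)) + (1 - q) * Real.exp (-(t * q)) ≤
      Real.exp (t ^ 2 * (q * (1 - q))) := by
  have e1 : |t * (1 - q)| ≤ 1 := by
    rw [abs_mul, abs_of_nonneg (sub_nonneg.2 h1)]
    nlinarith [abs_nonneg t]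
  have e2 : |-(t * q)| ≤ 1 := by
    rw [abs_neg, abs_mul, abs_of_nonneg h0]
    nlinarith [abs_nonneg t]
  -- By |exp x - 1 - x| ≤ x², the linear terms cancel since the variable is centred, and the
  -- quadratic ones add up to t² q (1 - q).
  have f1 := (abs_le.1 (Real.abs_exp_sub_one_sub_id_le e1)).2
  have f2 := (abs_le.1 (Real.abs_exp_sub_one_sub_id_le e2)).2
  have f3 := Real.add_one_le_exp (t ^ 2 * (q * (1 - q)))
  have g1 := mul_le_mul_of_nonneg_left f1 h0
  have g2 := mul_le_mul_of_nonneg_left f2 (sub_nonneg.2 h1)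
  nlinarith

lemma sum_subsetWeight_mul_exp_le (h0 : ∀ i ∈ U, 0 ≤ p i) (h1 : ∀ i ∈ U, p i ≤ 1) {a : ι → ℝ}
    (ha : ∀ i ∈ U, |a i| ≤ 1) :
    ∑ S ∈ U.powerset, subsetWeight U p S * Real.exp (∑ i ∈ S, a i - ∑ i ∈ U, p i * a i) ≤
      Real.exp (∑ i ∈ U, a i ^ 2 * (p i * (1 - p i))) := by
  have key : ∀ S ∈ U.powerset, Real.exp (∑ i ∈ S, a i - ∑ i ∈ U, p i * a i) =
      (∏ i ∈ S, Real.exp (a i * (1 - p i))) * ∏ i ∈ U \ S, Real.exp (-(a i * p i)) := by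
    intro S hS
    rw [← Real.exp_sum, ← Real.exp_sum, ← Real.exp_add]
    congr 1
    rw [← Finset.sum_sdiff (Finset.mem_powerset.1 hS)]
    have : ∑ i ∈ S, a i = ∑ i ∈ S, (a i * (1 - p i) + p i * a i) :=
      Finset.sum_congr rfl fun i _ => by ring
    rw [this, Finset.sum_add_distrib, Finset.sum_neg_distrib]
    simp only [mul_comm (a _) (p _)]
    ring
  rw [Finset.sum_congr rfl fun S hS => by rw [key S hS], sum_subsetWeight_mul_prod, Real.exp_sum]
  refine Finset.prod_le_prod (fun i hi => ?_) fun i hi => bernoulli_mgf_le (h0 i hi) (h1 i hi) (ha i hi)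
  have := h0 i hi
  have := sub_nonneg.2 (h1 i hi)
  positivity

/-- The expected amount by which a sum over a random subset deviates from its mean by more
than `Λ`. -/
lemma sum_subsetWeight_mul_deviation_le (h0 : ∀ i ∈ U, 0 ≤ p i) (h1 : ∀ i ∈ U, p i ≤ 1) {a : ι → ℝ}
    (ha0 : ∀ i ∈ U, 0 ≤ a i) (ha1 : ∀ i ∈ U, a i ≤ 1) {l Λ B : ℝ} (hl : 0 < l) (hl1 : l ≤ 1)
    (hB : ∑ i ∈ U, a i * (p i * (1 - p i)) ≤ B) :
    ∑ S ∈ U.powerset, subsetWeight U p S * max (|∑ i ∈ S, a i - ∑ i ∈ U, p i * a i| - Λ) 0 ≤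
      2 / l * Real.exp (-(l * Λ) + l ^ 2 * B) := by
  have bound : ∀ (ε : ℝ), |ε| = l →
      ∑ S ∈ U.powerset, subsetWeight U p S * Real.exp (ε * (∑ i ∈ S, a i - ∑ i ∈ U, p i * a i)) ≤
        Real.exp (l ^ 2 * B) := by
    intro ε hε
    have := sum_subsetWeight_mul_exp_le h0 h1 (a := fun i => ε * a i) (fun i hi => by
      rw [abs_mul, hε, abs_of_nonneg (ha0 i hi)]
      nlinarith [ha0 i hi, ha1 i hi])
    refine le_trans (le_of_eq ?_) (this.trans (Real.exp_le_exp.2 ?_))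
    · refine Finset.sum_congr rfl fun S _ => ?_
      rw [mul_sub, Finset.mul_sum, Finset.mul_sum]
      simp only [mul_left_comm]
    · refine le_trans ?_ (mul_le_mul_of_nonneg_left hB (sq_nonneg l))
      rw [Finset.mul_sum]
      refine Finset.sum_le_sum fun i hi => ?_
      have e : ε ^ 2 = l ^ 2 := by rw [← hε, sq_abs]
      have hp := mul_nonneg (h0 i hi) (sub_nonneg.2 (h1 i hi))
      rw [mul_pow, e, mul_assoc]
      refine mul_le_mul_of_nonneg_left (mul_le_mul_of_nonneg_right ?_ hp) (sq_nonneg l)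
      nlinarith [ha0 i hi, ha1 i hi]
  -- From y ≤ exp(l y) / l with y = |z| - Λ; both signs of z are covered by adding the two
  -- exponentials.
  have pt : ∀ z : ℝ, max (|z| - Λ) 0 ≤
      1 / l * Real.exp (-(l * Λ)) * (Real.exp (l * z) + Real.exp (-l * z)) := by
    intro z
    refine max_le ?_ (by positivity)
    have e1 : l * (|z| - Λ) ≤ Real.exp (-(l * Λ)) * Real.exp (l * |z|) := by
      rw [← Real.exp_add]
      have := Real.add_one_le_exp (-(l * Λ) + l * |z|)
      nlinarith
    have e2 : Real.exp (l * |z|) ≤ Real.exp (l * z) + Real.exp (-l * z) := by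
      rcases abs_cases z with ⟨h, -⟩ | ⟨h, -⟩ <;> rw [h]
      · linarith [Real.exp_pos (-l * z)]
      · rw [mul_neg, ← neg_mul]; linarith [Real.exp_pos (l * z)]
    have e3 := e1.trans (mul_le_mul_of_nonneg_left e2 (Real.exp_pos (-(l * Λ))).le)
    rw [mul_assoc, div_mul_eq_mul_div, one_mul, le_div_iff₀ hl]
    linarith
  calc _ ≤ ∑ S ∈ U.powerset, subsetWeight U p S * (1 / l * Real.exp (-(l * Λ)) *
          (Real.exp (l * (∑ i ∈ S, a i - ∑ i ∈ U, p i * a i)) +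
            Real.exp (-l * (∑ i ∈ S, a i - ∑ i ∈ U, p i * a i)))) :=
        Finset.sum_le_sum fun S hS => mul_le_mul_of_nonneg_left (pt _)
          (subsetWeight_nonneg h0 h1 (Finset.mem_powerset.1 hS))
    _ = 1 / l * Real.exp (-(l * Λ)) *
        (∑ S ∈ U.powerset, subsetWeight U p S * Real.exp (l * (∑ i ∈ S, a i - ∑ i ∈ U, p i * a i))
        + ∑ S ∈ U.powerset, subsetWeight U p S *
            Real.exp (-l * (∑ i ∈ S, a i - ∑ i ∈ U, p i * a i))) := by
        rw [← Finset.sum_add_distrib, Finset.mul_sum]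
        exact Finset.sum_congr rfl fun S _ => by ring
    _ ≤ 1 / l * Real.exp (-(l * Λ)) * (Real.exp (l ^ 2 * B) + Real.exp (l ^ 2 * B)) := by
        refine mul_le_mul_of_nonneg_left (add_le_add (bound l (abs_of_pos hl))
          (bound (-l) (by rw [abs_neg, abs_of_pos hl]))) (by positivity)
    _ = _ := by rw [Real.exp_add]; ring

lemma exists_subset_neg_of_sum_neg (h0 : ∀ i ∈ U, 0 ≤ p i) (h1 : ∀ i ∈ U, p i ≤ 1)
    {F : Finset ι → ℝ} (hF : ∑ S ∈ U.powerset, subsetWeight U p S * F S < 0) :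
    ∃ S ⊆ U, F S < 0 := by
  by_contra! h
  refine absurd (Finset.sum_nonneg fun S hS => ?_) (not_le.2 hF)
  have hS := Finset.mem_powerset.1 hS
  exact mul_nonneg (subsetWeight_nonneg h0 h1 hS) (h S hS)

end RandomSubset

/-! ### Nearly regular weightings and the halving of their width. -/

namespace SimpleGraph

variable {V : Type*}

/-- Symmetric weights in `[0, 1]` on the edges of `G`. -/
structure IsEdgeWeight (G : SimpleGraph V) (h : V → V → ℝ) : Prop where
  symm : ∀ v w, h v w = h w v
  nonneg : ∀ v w, 0 ≤ h v w
  le_one : ∀ v w, h v w ≤ 1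
  adj : ∀ v w, h v w ≠ 0 → G.Adj v w

/-- `G` has an edge weighting on a non-empty set of vertices for which the weighted degrees deviate
from `T` by at most `Λ`, up to an error that is at most `η` on average. -/
def HasNearRegularWeight (G : SimpleGraph V) (T Λ η : ℝ) : Prop :=
  ∃ (U : Finset V) (h : V → V → ℝ), U.Nonempty ∧ G.IsEdgeWeight h ∧
    ∑ v ∈ U, max (|∑ w ∈ U, h v w - T| - Λ) 0 ≤ η * U.card

lemma abs_sub_clamp_le {T Λ : ℝ} (hΛ : 0 ≤ Λ) (x : ℝ) :
    |x - max (T - Λ) (min (T + Λ) x)| ≤ max (|x - T| - Λ) 0 := by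
  rcases le_total x (T - Λ) with h1 | h1
  · rw [min_eq_right (by linarith), max_eq_left h1, abs_of_nonpos (by linarith)]
    exact le_max_of_le_left (by linarith [neg_abs_le (x - T)])
  rcases le_total x (T + Λ) with h2 | h2
  · rw [min_eq_right h2, max_eq_right h1, sub_self, abs_zero]
    exact le_max_right _ _
  · rw [min_eq_left h2, max_eq_right (by linarith), abs_of_nonneg (by linarith)]
    exact le_max_of_le_left (by linarith [le_abs_self (x - T)])

/-- Sampling the vertices with probabilities proportional to their truncated degrees. -/
lemma HasNearRegularWeight.halve {G : SimpleGraph V} {T Λ η η' : ℝ}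
    (hG : G.HasNearRegularWeight T Λ η) (hΛ : 0 < Λ) (hΛT : 20 * Λ ≤ T) (hη' : 0 ≤ η')
    (hη : η * (1 + 4 * Λ / T) + 48 * Real.exp (-(Λ / 96)) < η' * (1 - 2 * Λ / (T + Λ))) :
    G.HasNearRegularWeight ((T - Λ) ^ 2 / (T + Λ)) (Λ / 2) η' := by
  classical
  obtain ⟨U, h, hU, hw, hdev⟩ := hG
  set T' := (T - Λ) ^ 2 / (T + Λ) with hT'
  have hT : 0 < T := by linarith
  have hlo : 0 < T - Λ := by linarith
  have hhi : 0 < T + Λ := by linarith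
  have hT'hi : T' * (T + Λ) = (T - Λ) ^ 2 := div_mul_cancel₀ _ hhi.ne'
  have hT'0 : 0 ≤ T' := by positivity
  have hT'lo : T' ≤ T - Λ := by rw [hT', div_le_iff₀ hhi]; nlinarith
  have hT'3 : T - 3 * Λ ≤ T' := by rw [hT', le_div_iff₀ hhi]; nlinarith
  set d : V → ℝ := fun v => ∑ w ∈ U, h v w with hd
  set c : V → ℝ := fun v => max (T - Λ) (min (T + Λ) (d v)) with hc
  have hclo : ∀ v, T - Λ ≤ c v := fun v => le_max_left _ _
  have hchi : ∀ v, c v ≤ T + Λ := fun v => max_le (by linarith) (min_le_left _ _)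
  have hc0 : ∀ v, 0 < c v := fun v => hlo.trans_le (hclo v)
  set p : V → ℝ := fun v => c v / (T + Λ) with hp
  have hp0 : ∀ v, 0 ≤ p v := fun v => (div_pos (hc0 v) hhi).le
  have hp1 : ∀ v, p v ≤ 1 := fun v => (div_le_one hhi).2 (hchi v)
  have hplo : ∀ v, 1 - 2 * Λ / (T + Λ) ≤ p v := fun v => by
    rw [hp, le_div_iff₀ hhi, sub_mul, div_mul_cancel₀ _ hhi.ne']
    linarith [hclo v]
  -- The factor 1 / c w cancels the sampling bias p w, and 1 / c v moves the mean at each v with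
  -- degree in the window to exactly T'. The numerators T - Λ, the least possible value of c, keep
  -- h' ≤ h.
  set h' : V → V → ℝ := fun v w => h v w * ((T - Λ) / c v) * ((T - Λ) / c w) with hh'
  have hr0 : ∀ v, 0 ≤ (T - Λ) / c v := fun v => (div_pos hlo (hc0 v)).le
  have hr1 : ∀ v, (T - Λ) / c v ≤ 1 := fun v => (div_le_one (hc0 v)).2 (hclo v)
  have hh'0 : ∀ v w, 0 ≤ h' v w := fun v w =>
    mul_nonneg (mul_nonneg (hw.nonneg v w) (hr0 v)) (hr0 w)
  have hh'h : ∀ v w, h' v w ≤ h v w := fun v w =>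
    (mul_le_of_le_one_right (mul_nonneg (hw.nonneg v w) (hr0 v)) (hr1 w)).trans
      (mul_le_of_le_one_right (hw.nonneg v w) (hr1 v))
  have hw' : G.IsEdgeWeight h' :=
    { symm := fun v w => by simp only [hh', hw.symm v w]; ring
      nonneg := hh'0
      le_one := fun v w => (hh'h v w).trans (hw.le_one v w)
      adj := fun v w hvw => hw.adj v w fun h0 => hvw (by simp [hh', h0]) }
  have hmean : ∀ v, ∑ w ∈ U, p w * h' v w = T' * (d v / c v) := by
    intro v
    rw [hd, Finset.sum_div, Finset.mul_sum]
    refine Finset.sum_congr rfl fun w _ => ?_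
    have := (hc0 v).ne'
    have := (hc0 w).ne'
    simp only [hp, hh', hT']
    field_simp
  have hd0 : ∀ v, 0 ≤ d v := fun v => Finset.sum_nonneg fun w _ => hw.nonneg v w
  have hdisp : ∀ v, |T' * (d v / c v) - T'| ≤ max (|d v - T| - Λ) 0 := by
    intro v
    have e : T' * (d v / c v) - T' = T' / c v * (d v - c v) := by
      have := (hc0 v).ne'
      field_simp
    have e1 : T' / c v ≤ 1 := (div_le_one (hc0 v)).2 (hT'lo.trans (hclo v))
    have e2 : |d v - c v| ≤ max (|d v - T| - Λ) 0 := by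
      exact abs_sub_clamp_le hΛ.le (d v)
    rw [e, abs_mul, abs_of_nonneg (div_nonneg hT'0 (hc0 v).le)]
    exact (mul_le_of_le_one_left (abs_nonneg _) e1).trans e2
  have hpt : ∀ v ∈ U, ∑ S ∈ U.powerset, subsetWeight U p S *
      max (|∑ w ∈ S, h' v w - T'| - Λ / 2) 0 ≤
        max (|d v - T| - Λ) 0 * (1 + 4 * Λ / T) + 48 * Real.exp (-(Λ / 96)) := by
    intro v _
    have hwt : ∀ S ∈ U.powerset, 0 ≤ subsetWeight U p S := fun S hS =>
      subsetWeight_nonneg (fun i _ => hp0 i) (fun i _ => hp1 i) (Finset.mem_powerset.1 hS)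
    have hfrac : 0 ≤ 4 * Λ / T := by positivity
    have hexc : 0 ≤ max (|d v - T| - Λ) 0 := le_max_right _ _
    -- Up to 3T the variance is at most 6Λ because 1 - p is O(Λ/T), and concentration applies.
    -- Beyond 3T the excess is already at least T, so the trivial bound by d v costs only a factor 1
    -- + 4Λ/T.
    rcases le_or_gt (d v) (3 * T) with hdv | hdv
    · have hB : ∑ w ∈ U, h' v w * (p w * (1 - p w)) ≤ 6 * Λ := by
        calc _ ≤ ∑ w ∈ U, 2 * Λ / (T + Λ) * (p w * h' v w) := by
              refine Finset.sum_le_sum fun w _ => ?_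
              have := mul_le_mul_of_nonneg_left (show 1 - p w ≤ 2 * Λ / (T + Λ) by
                linarith [hplo w]) (mul_nonneg (hp0 w) (hh'0 v w))
              linarith
          _ = 2 * Λ / (T + Λ) * (T' * (d v / c v)) := by rw [← Finset.mul_sum, hmean]
          _ ≤ 2 * Λ / (T + Λ) * (T' * (3 * T / (T - Λ))) := by
              have := hclo v
              gcongr
          _ ≤ 6 * Λ := by
              have e1 : T' * (3 * T / (T - Λ)) ≤ 3 * T := by
                rw [mul_div_assoc', div_le_iff₀ hlo]
                nlinarith
              have e2 : 2 * Λ / (T + Λ) * (3 * T) ≤ 6 * Λ := by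
                rw [div_mul_eq_mul_div, div_le_iff₀ hhi]
                nlinarith
              exact (mul_le_mul_of_nonneg_left e1 (by positivity)).trans e2
      -- With l = 1/24 the exponent is -Λ/48 + Λ/96 = -Λ/96.
      have htail := sum_subsetWeight_mul_deviation_le (U := U) (p := p) (a := h' v) (l := 1 / 24)
        (Λ := Λ / 2) (fun i _ => hp0 i) (fun i _ => hp1 i) (fun i _ => hh'0 v i)
        (fun i _ => hw'.le_one v i) (by norm_num) (by norm_num) hB
      rw [hmean] at htail
      have e : 2 / (1 / 24 : ℝ) * Real.exp (-(1 / 24 * (Λ / 2)) + (1 / 24) ^ 2 * (6 * Λ)) =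
          48 * Real.exp (-(Λ / 96)) := by
        congr 1
        · norm_num
        · congr 1; ring
      rw [e] at htail
      calc _ ≤ ∑ S ∈ U.powerset, (subsetWeight U p S *
              max (|∑ w ∈ S, h' v w - T' * (d v / c v)| - Λ / 2) 0 +
              subsetWeight U p S * max (|d v - T| - Λ) 0) := by
            refine Finset.sum_le_sum fun S hS => ?_
            rw [← mul_add]
            refine mul_le_mul_of_nonneg_left ?_ (hwt S hS)
            have := hdisp v
            have := abs_sub_le (∑ w ∈ S, h' v w) (T' * (d v / c v)) T'
            refine max_le ?_ (add_nonneg (le_max_right _ _) hexc)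
            linarith [le_max_left (|∑ w ∈ S, h' v w - T' * (d v / c v)| - Λ / 2) 0]
        _ ≤ 48 * Real.exp (-(Λ / 96)) + max (|d v - T| - Λ) 0 := by
            rw [Finset.sum_add_distrib, ← Finset.sum_mul, sum_subsetWeight, one_mul]
            linarith
        _ ≤ _ := by nlinarith
    · have hexc' : max (|d v - T| - Λ) 0 = d v - T - Λ := by
        rw [abs_of_pos (by linarith), max_eq_left (by linarith)]
      have hgrow : d v - T' - Λ / 2 ≤ (d v - T - Λ) * (1 + 4 * Λ / T) := by
        have : 4 * Λ ≤ (d v - T - Λ) * (4 * Λ / T) := by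
          rw [mul_div_assoc', le_div_iff₀ hT]
          nlinarith
        linarith
      calc _ ≤ ∑ S ∈ U.powerset, subsetWeight U p S * ((d v - T - Λ) * (1 + 4 * Λ / T)) := by
            refine Finset.sum_le_sum fun S hS => mul_le_mul_of_nonneg_left ?_ (hwt S hS)
            have z0 : 0 ≤ ∑ w ∈ S, h' v w := Finset.sum_nonneg fun w _ => hh'0 v w
            have z1 : ∑ w ∈ S, h' v w ≤ d v :=
              (Finset.sum_le_sum fun w _ => hh'h v w).trans
                (Finset.sum_le_sum_of_subset_of_nonneg (Finset.mem_powerset.1 hS)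
                  fun w _ _ => hw.nonneg v w)
            have : |∑ w ∈ S, h' v w - T'| ≤ d v - T' := abs_le.2 ⟨by linarith, by linarith⟩
            refine max_le (by linarith) ?_
            have : 0 ≤ d v - T - Λ := by linarith
            positivity
        _ ≤ _ := by
            rw [← Finset.sum_mul, sum_subsetWeight, one_mul, hexc']
            linarith [Real.exp_pos (-(Λ / 96))]
  -- The excess is summed over all of U, not only over S, so the membership of v in S never
  -- interacts with its degree into S. A negative value also rules out S = ∅.
  have hneg : ∑ S ∈ U.powerset, subsetWeight U p S *
      (∑ v ∈ U, max (|∑ w ∈ S, h' v w - T'| - Λ / 2) 0 - η' * S.card) < 0 := by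
    have hcard : (0 : ℝ) < U.card := by exact_mod_cast hU.card_pos
    have e1 : ∑ S ∈ U.powerset, subsetWeight U p S *
        (∑ v ∈ U, max (|∑ w ∈ S, h' v w - T'| - Λ / 2) 0 - η' * S.card) =
        ∑ v ∈ U, ∑ S ∈ U.powerset, subsetWeight U p S * max (|∑ w ∈ S, h' v w - T'| - Λ / 2) 0 -
          η' * ∑ v ∈ U, p v := by
      rw [Finset.sum_comm]
      have := sum_subsetWeight_mul_sum (U := U) (p := p) fun _ => 1
      simp only [mul_one, Finset.sum_const, nsmul_eq_mul] at this
      rw [← this, Finset.mul_sum, ← Finset.sum_sub_distrib]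
      refine Finset.sum_congr rfl fun S _ => ?_
      rw [← Finset.mul_sum]
      ring
    have e2 : (U.card : ℝ) * (1 - 2 * Λ / (T + Λ)) ≤ ∑ v ∈ U, p v := by
      rw [← nsmul_eq_mul]
      exact Finset.card_nsmul_le_sum _ _ _ fun v _ => hplo v
    have e3 := Finset.sum_le_sum hpt
    rw [Finset.sum_add_distrib, ← Finset.sum_mul, Finset.sum_const, nsmul_eq_mul] at e3
    have e4 : (∑ v ∈ U, max (|d v - T| - Λ) 0) * (1 + 4 * Λ / T) ≤
        η * U.card * (1 + 4 * Λ / T) := mul_le_mul_of_nonneg_right hdev (by positivity)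
    rw [e1]
    nlinarith [mul_le_mul_of_nonneg_left e2 hη', mul_lt_mul_of_pos_right hη hcard]
  obtain ⟨S, hSU, hS⟩ := exists_subset_neg_of_sum_neg (fun i _ => hp0 i) (fun i _ => hp1 i) hneg
  have hle : ∑ v ∈ S, max (|∑ w ∈ S, h' v w - T'| - Λ / 2) 0 ≤
      ∑ v ∈ U, max (|∑ w ∈ S, h' v w - T'| - Λ / 2) 0 :=
    Finset.sum_le_sum_of_subset_of_nonneg hSU fun _ _ _ => le_max_right _ _
  refine ⟨S, h', ?_, hw', by linarith⟩
  rw [Finset.nonempty_iff_ne_empty]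
  rintro rfl
  rw [Finset.card_empty, Nat.cast_zero, mul_zero, sub_zero] at hS
  exact absurd (Finset.sum_nonneg fun v _ => le_max_right _ _) (not_le.2 hS)

/-- The cubic term of the exponential series suffices, and 32000 is close to where it starts to do
so. -/
lemma exp_tail_le {Λ : ℝ} (hΛ : 32000 ≤ Λ) : 48 * Real.exp (-(Λ / 96)) ≤ 1 / (4 * Λ) := by
  have h := Real.pow_div_factorial_le_exp (x := Λ / 96) (by linarith) 3
  rw [Real.exp_neg, ← div_eq_mul_inv, div_le_div_iff₀ (Real.exp_pos _) (by linarith)]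
  norm_num [Nat.factorial] at h
  nlinarith [mul_self_nonneg Λ, mul_self_nonneg (Λ - 32000)]

/-- Both bounds are shaped to telescope. A step costs at most 3Λ in T', which is the drop of 6Λ when
Λ halves. The relative error growth, about 12Λ/T, fits into the 14Λ/T released by the term -28Λ/T,
while the doubling of 1/Λ absorbs the tail 1/(4Λ). -/
lemma HasNearRegularWeight.iterate_halve {G : SimpleGraph V} {T : ℝ} (hT : 3200000 ≤ T)
    (hG : G.HasNearRegularWeight T (T / 100) (1 / 2)) (j : ℕ)
    (hj : 16000 ≤ T / 100 / 2 ^ j) :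
    ∃ T', T / 2 + 6 * (T / 100 / 2 ^ j) ≤ T' ∧ G.HasNearRegularWeight T' (T / 100 / 2 ^ j)
      (1 - 28 * (T / 100 / 2 ^ j) / T + 1 / (T / 100 / 2 ^ j)) := by
  induction j with
  | zero =>
    refine ⟨T, by linarith, ?_⟩
    obtain ⟨U, h, hU, hw, hdev⟩ := hG
    refine ⟨U, h, hU, hw, ?_⟩
    rw [pow_zero, div_one]
    refine hdev.trans (mul_le_mul_of_nonneg_right ?_ (Nat.cast_nonneg _))
    have : 28 * (T / 100) / T = 28 / 100 := by field_simp
    have : 0 < 1 / (T / 100) := by positivity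
    linarith
  | succ j ih =>
    set Λ := T / 100 / 2 ^ j with hΛ
    have e : T / 100 / 2 ^ (j + 1) = Λ / 2 := by rw [hΛ, pow_succ, div_div (T / 100)]
    rw [e] at hj ⊢
    obtain ⟨T', hT', hG'⟩ := ih (by linarith)
    have hΛT : Λ ≤ T / 100 := div_le_self (by linarith) (one_le_pow₀ (by norm_num))
    have hΛ0 : 0 < Λ := by linarith
    have hT0 : 0 < T := by linarith
    have hT'0 : 0 < T' := by linarith
    refine ⟨(T' - Λ) ^ 2 / (T' + Λ), ?_, hG'.halve hΛ0 (by linarith) ?_ ?_⟩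
    · have : T' - 3 * Λ ≤ (T' - Λ) ^ 2 / (T' + Λ) := by
        rw [le_div_iff₀ (by linarith)]; nlinarith
      linarith
    · have : 28 * (Λ / 2) / T ≤ 1 := (div_le_one hT0).2 (by linarith)
      have : 0 < 1 / (Λ / 2) := by positivity
      linarith
    · set z := Λ / T with hz
      have hz0 : 0 < z := by positivity
      have hz1 : z ≤ 1 / 100 := by rw [hz, div_le_iff₀ hT0]; linarith
      have hzΛ : z * (1 / Λ) = 1 / T := by rw [hz]; field_simp
      have e1 : 28 * Λ / T = 28 * z := by rw [hz]; ring
      have e2 : 28 * (Λ / 2) / T = 14 * z := by rw [hz]; ring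
      have e3 : 1 / (Λ / 2) = 2 * (1 / Λ) := by field_simp
      have e4 : 4 * Λ / T' ≤ 8 * z := by
        rw [hz, show 8 * (Λ / T) = 8 * Λ / T by ring, div_le_div_iff₀ hT'0 hT0]; nlinarith
      have e5 : 2 * Λ / (T' + Λ) ≤ 2 * Λ / T' := by gcongr; linarith
      have e6 : 48 * Real.exp (-(Λ / 96)) ≤ 1 / (4 * Λ) := exp_tail_le (by linarith)
      have e7 : 1 / (4 * Λ) = 1 / 4 * (1 / Λ) := by field_simp
      set y := 1 / Λ with hy
      have hy0 : 0 < y := by positivity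
      have e8 : 2 * Λ / T' = (4 * Λ / T') / 2 := by ring
      set x := 4 * Λ / T' with hx
      have hx0 : 0 < x := by positivity
      rw [e1, e2, e3]
      have hη0 : 0 ≤ 1 - 14 * z + 2 * y := by nlinarith
      have g1 : (1 - 14 * z + 2 * y) * (1 - x / 2) ≤
          (1 - 14 * z + 2 * y) * (1 - 2 * Λ / (T' + Λ)) :=
        mul_le_mul_of_nonneg_left (by linarith) hη0
      refine lt_of_lt_of_le ?_ g1
      have g2 : (1 - 28 * z + y) * (1 + x) + 1 / 4 * y < (1 - 14 * z + 2 * y) * (1 - x / 2) := by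
        nlinarith [mul_pos hz0 hx0, mul_pos hy0 hx0, mul_pos hz0 hy0]
      linarith

end SimpleGraph

/-! ### Balanced flows from a densest subset. -/

/-- A fractional version of Hall's theorem with edge capacities: if every set `W ⊆ X` can send
`R * |W|` units, then all vertices of `X` can send `R` units simultaneously. -/
lemma exists_flow_of_hall {α β : Type*} [Fintype α] [Fintype β] [DecidableEq α] [DecidableEq β]
    (X : Finset α) {c : α → β → ℝ} {w : β → ℝ} {R : ℝ} (hR : 0 ≤ R) (hc : ∀ x y, 0 ≤ c x y)
    (hw : ∀ y, 0 ≤ w y)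
    (hall : ∀ W ⊆ X, R * W.card ≤ ∑ y, min (w y) (∑ x ∈ W, c x y)) :
    ∃ g : α → β → ℝ, (∀ x y, 0 ≤ g x y) ∧ (∀ x y, g x y ≤ c x y) ∧
      (∀ y, ∑ x ∈ X, g x y ≤ w y) ∧ ∀ x ∈ X, ∑ y, g x y = R := by
  set P : Set (α → β → ℝ) := Set.Icc 0 c ∩ {g | ∀ y, ∑ x ∈ X, g x y ≤ w y} with hP
  have hPc : IsCompact P := by
    refine isCompact_Icc.inter_right ?_
    simp only [Set.ofPred_forall]
    exact isClosed_iInter fun y => isClosed_le (by fun_prop) continuous_const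
  -- A feasible flow minimising the squared deviation of the row sums from R; `shift` records its
  -- optimality against changes in one column.
  obtain ⟨g, ⟨⟨hg0, hgc⟩, hgw⟩, hmin⟩ := hPc.exists_isMinOn
    ⟨0, ⟨le_rfl, fun x y => hc x y⟩, fun y => by simpa using hw y⟩
    (f := fun g : α → β → ℝ => ∑ x ∈ X, (R - ∑ y, g x y) ^ 2) (by fun_prop)
  set r : α → ℝ := fun x => ∑ y, g x y with hr
  have shift : ∀ (y₀ : β) (τ : α → ℝ), (∀ x, 0 ≤ g x y₀ + τ x) → (∀ x, g x y₀ + τ x ≤ c x y₀) →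
      ∑ x ∈ X, g x y₀ + ∑ x ∈ X, τ x ≤ w y₀ → 0 ≤ ∑ x ∈ X, (τ x ^ 2 - 2 * τ x * (R - r x)) := by
    intro y₀ τ h0 h1 h2
    have hmem : (fun x y => g x y + if y = y₀ then τ x else 0) ∈ P := by
      refine ⟨⟨fun x y => ?_, fun x y => ?_⟩, fun y => ?_⟩
      · by_cases hy : y = y₀
        · subst hy; simpa using h0 x
        · simpa [hy] using hg0 x y
      · by_cases hy : y = y₀
        · subst hy; simpa using h1 x
        · simpa [hy] using hgc x y
      · by_cases hy : y = y₀
        · subst hy; simpa [Finset.sum_add_distrib] using h2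
        · simpa [hy] using hgw y
    have := hmin hmem
    simp only [Set.mem_ofPred_eq, Finset.sum_add_distrib, Finset.sum_ite_eq', Finset.mem_univ,
      if_true] at this
    rw [← sub_nonneg, ← Finset.sum_sub_distrib] at this
    refine this.trans (le_of_eq (Finset.sum_congr rfl fun x _ => ?_))
    simp only [hr]
    ring
  have hge : ∀ x ∈ X, R ≤ r x := by
    by_contra! hcon
    obtain ⟨x₁, hx₁, hx₁R⟩ := hcon
    set W := X.filter fun x => r x < R with hW
    have hWX : W ⊆ X := Finset.filter_subset _ _
    -- If some x₀ ∈ W has spare capacity to y, minimality forces the column to be saturated, and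
    -- saturated from W alone: mass sent by x ∉ W could be moved to x₀. Summing over y contradicts
    -- the Hall condition for W.
    have hcol : ∀ y, min (w y) (∑ x ∈ W, c x y) ≤ ∑ x ∈ W, g x y := by
      intro y
      by_cases hfull : ∀ x ∈ W, g x y = c x y
      · exact (min_le_right _ _).trans (Finset.sum_le_sum fun x hx => (hfull x hx).ge)
      push Not at hfull
      obtain ⟨x₀, hx₀, hne⟩ := hfull
      obtain ⟨hx₀X, hx₀R⟩ := Finset.mem_filter.1 hx₀
      have hlt : 0 < c x₀ y - g x₀ y := sub_pos.2 (lt_of_le_of_ne (hgc x₀ y) hne)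
      have hlt' : 0 < R - r x₀ := sub_pos.2 hx₀R
      have hsat : ∑ x ∈ X, g x y = w y := by
        by_contra hns
        have hs : 0 < w y - ∑ x ∈ X, g x y := sub_pos.2 (lt_of_le_of_ne (hgw y) hns)
        obtain ⟨ε, hε0, hε⟩ := exists_between (lt_min (lt_min hlt hs) hlt')
        obtain ⟨hε', hε3⟩ := lt_min_iff.1 hε
        obtain ⟨hε1, hε2⟩ := lt_min_iff.1 hε'
        have := shift y (fun x => if x = x₀ then ε else 0)
          (fun x => add_nonneg (hg0 x y) (by split_ifs <;> linarith))
          (fun x => by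
            split_ifs with h
            · subst h; linarith
            · simpa using hgc x y)
          (by simp only [Finset.sum_ite_eq', hx₀X, if_true]; linarith)
        have e : ∀ x, ((if x = x₀ then ε else 0) ^ 2 - 2 * (if x = x₀ then ε else 0) * (R - r x)) =
            if x = x₀ then ε ^ 2 - 2 * ε * (R - r x₀) else 0 := by
          intro x
          split_ifs with h
          · subst h; rfl
          · ring
        simp only [e, Finset.sum_ite_eq', hx₀X, if_true] at this
        nlinarith
      refine (min_le_left _ _).trans (le_of_eq ?_)
      rw [← hsat]
      symm
      refine Finset.sum_subset hWX fun x hxX hxW => ?_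
      by_contra hpos
      have hxR : R ≤ r x := by
        by_contra h
        exact hxW (Finset.mem_filter.2 ⟨hxX, not_le.1 h⟩)
      have hgpos : 0 < g x y := lt_of_le_of_ne (hg0 x y) (Ne.symm hpos)
      have hne' : x ≠ x₀ := fun h => by subst h; linarith
      obtain ⟨ε, hε0, hε⟩ := exists_between (lt_min (lt_min hlt hgpos) hlt')
      obtain ⟨hε', hε3⟩ := lt_min_iff.1 hε
      obtain ⟨hε1, hε2⟩ := lt_min_iff.1 hε'
      have := shift y (fun z => (if z = x₀ then ε else 0) + if z = x then -ε else 0)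
        (fun z => by
          have := hg0 z y
          simp only [Pi.zero_apply] at this
          split_ifs with h1 h2 h2
          · exact absurd (h2.symm.trans h1) hne'
          · linarith
          · subst h2; linarith
          · linarith)
        (fun z => by
          have := hgc z y
          split_ifs with h1 h2 h2
          · exact absurd (h2.symm.trans h1) hne'
          · subst h1; linarith
          · linarith
          · linarith)
        (by
          simp only [Finset.sum_add_distrib, Finset.sum_ite_eq', hx₀X, hxX, if_true]
          linarith [hgw y])
      have e : ∀ z, (((if z = x₀ then ε else 0) + if z = x then -ε else 0) ^ 2 -
          2 * ((if z = x₀ then ε else 0) + if z = x then -ε else 0) * (R - r z)) =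
          (if z = x₀ then ε ^ 2 - 2 * ε * (R - r x₀) else 0) +
            if z = x then ε ^ 2 + 2 * ε * (R - r x) else 0 := by
        intro z
        split_ifs with h1 h2 h2
        · exact absurd (h2.symm.trans h1) hne'
        · subst h1; ring
        · subst h2; ring
        · ring
      simp only [e, Finset.sum_add_distrib, Finset.sum_ite_eq', hx₀X, hxX, if_true] at this
      nlinarith
    have h1 := (hall W hWX).trans (Finset.sum_le_sum fun y _ => hcol y)
    rw [Finset.sum_comm] at h1
    have h2 : ∑ x ∈ W, ∑ y, g x y < ∑ x ∈ W, R :=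
      Finset.sum_lt_sum_of_nonempty ⟨x₁, Finset.mem_filter.2 ⟨hx₁, hx₁R⟩⟩
        fun x hx => (Finset.mem_filter.1 hx).2
    rw [Finset.sum_const, nsmul_eq_mul] at h2
    linarith
  -- The minimiser may overshoot R in some rows, and scaling these down preserves all upper bounds.
  set ρ : α → ℝ := fun x => if x ∈ X then R / r x else 0 with hρ
  have hr0 : ∀ x, 0 ≤ r x := fun x => Finset.sum_nonneg fun y _ => hg0 x y
  have hρ0 : ∀ x, 0 ≤ ρ x := fun x => by
    simp only [hρ]; split_ifs
    · exact div_nonneg hR (hr0 x)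
    · exact le_rfl
  have hρ1 : ∀ x, ρ x ≤ 1 := fun x => by
    simp only [hρ]; split_ifs with h
    · exact div_le_one_of_le₀ (hge x h) (hr0 x)
    · exact zero_le_one
  have hle : ∀ x y, ρ x * g x y ≤ g x y := fun x y => mul_le_of_le_one_left (hg0 x y) (hρ1 x)
  refine ⟨fun x y => ρ x * g x y, fun x y => mul_nonneg (hρ0 x) (hg0 x y),
    fun x y => (hle x y).trans (hgc x y),
    fun y => (Finset.sum_le_sum fun x _ => hle x y).trans (hgw y), fun x hx => ?_⟩
  rw [← Finset.mul_sum]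
  simp only [hρ, hx, if_true]
  rcases eq_or_ne (r x) 0 with h | h
  · have := hge x hx
    rw [h] at this ⊢
    rw [div_zero, zero_mul]
    exact le_antisymm hR this
  · exact div_mul_cancel₀ _ h

/-- Bernoulli's inequality at -j/d. It turns the loss from deleting j neighbours into j edge
capacities m d^(m-1). -/
lemma pow_sub_pow_le_mul {d j : ℝ} (hj : 0 ≤ j) (hjd : j ≤ d) (m : ℕ) :
    d ^ m - (d - j) ^ m ≤ j * (m * d ^ (m - 1)) := by
  rcases Nat.eq_zero_or_pos m with rfl | hm
  · simp
  rcases (hj.trans hjd).eq_or_lt with hd | hd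
  · have : j = 0 := le_antisymm (hjd.trans hd.symm.le) hj
    simp [this]
  · have h1 : -2 ≤ -(j / d) := by
      have := (div_le_one hd).2 hjd
      linarith
    have h2 := one_add_mul_le_pow h1 m
    have e1 : (d - j) ^ m = d ^ m * (1 + -(j / d)) ^ m := by
      rw [← mul_pow]
      congr 1
      field_simp
      ring
    have e2 : d ^ m * (m * (j / d)) = j * (m * d ^ (m - 1)) := by
      obtain ⟨k, rfl⟩ := Nat.exists_eq_succ_of_ne_zero hm.ne'
      rw [Nat.succ_sub_one, pow_succ]
      field_simp
    rw [e1, ← e2]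
    nlinarith [mul_le_mul_of_nonneg_left h2 (pow_pos hd m).le]

namespace SimpleGraph

variable {V : Type*} [Fintype V] [DecidableEq V] (G : SimpleGraph V) [DecidableRel G.Adj]

/-- A subset `X` of `A` maximising the density `∑ y ∈ B, d_X(y) ^ m / |X|` carries a flow which
distributes the weights `d_X(y) ^ m` of the vertices of `B` evenly over `X`. -/
lemma exists_balanced_flow (A B : Finset V) (hA : A.Nonempty) {m : ℕ} (hm : m ≠ 0) :
    ∃ X ⊆ A, X.Nonempty ∧ ∃ (R : ℝ) (g : V → V → ℝ),
      ∑ y ∈ B, ((A.filter (G.Adj y)).card : ℝ) ^ m ≤ R * A.card ∧ (∀ x y, 0 ≤ g x y) ∧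
      (∀ x y, g x y ≠ 0 → G.Adj x y ∧ y ∈ B) ∧
      (∀ x y, g x y ≤ m * ((X.filter (G.Adj y)).card : ℝ) ^ (m - 1)) ∧
      (∀ y ∈ B, ∑ x ∈ X, g x y = ((X.filter (G.Adj y)).card : ℝ) ^ m) ∧
      ∀ x ∈ X, ∑ y ∈ B, g x y = R := by
  let S : Finset V → ℝ := fun X => ∑ y ∈ B, ((X.filter (G.Adj y)).card : ℝ) ^ m
  obtain ⟨X, hX, hmax⟩ := Finset.exists_max_image (A.powerset.filter Finset.Nonempty)
    (fun X => S X / X.card) ⟨A, by simpa using hA⟩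
  rw [Finset.mem_filter, Finset.mem_powerset] at hX
  obtain ⟨hXA, hXne⟩ := hX
  have hcard : ∀ {Z : Finset V}, Z.Nonempty → (0 : ℝ) < Z.card := fun h => by
    exact_mod_cast Finset.card_pos.2 h
  set R := S X / X.card with hR
  have hRX : R * X.card = S X := div_mul_cancel₀ _ (hcard hXne).ne'
  have hle : ∀ Z ⊆ A, S Z ≤ R * Z.card := by
    intro Z hZ
    rcases Z.eq_empty_or_nonempty with rfl | hne
    · simp [S, hm]
    · have := hmax Z (Finset.mem_filter.2 ⟨Finset.mem_powerset.2 hZ, hne⟩)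
      exact (div_le_iff₀ (hcard hne)).1 this
  have hR0 : 0 ≤ R := div_nonneg (Finset.sum_nonneg fun y _ => by positivity) (Nat.cast_nonneg _)
  let w : V → ℝ := fun y => if y ∈ B then ((X.filter (G.Adj y)).card : ℝ) ^ m else 0
  let c : V → V → ℝ := fun x y =>
    if G.Adj x y ∧ y ∈ B then m * ((X.filter (G.Adj y)).card : ℝ) ^ (m - 1) else 0
  have hsumw : ∀ f : V → ℝ, (∑ y, if y ∈ B then f y else 0) = ∑ y ∈ B, f y := fun f => by
    rw [Finset.sum_ite_mem, Finset.univ_inter]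
  -- Since X \ W is no denser than X, deleting W loses at least R |W| of the total S X.
  have hall : ∀ W ⊆ X, R * W.card ≤ ∑ y, min (w y) (∑ x ∈ W, c x y) := by
    intro W hW
    have h1 := hle (X \ W) (Finset.sdiff_subset.trans hXA)
    have hc : ((X \ W).card : ℝ) = X.card - W.card := by
      rw [Finset.card_sdiff_of_subset hW, Nat.cast_sub (Finset.card_le_card hW)]
    rw [hc, mul_sub, hRX] at h1
    refine (show R * W.card ≤ S X - S (X \ W) by linarith).trans ?_
    rw [← Finset.sum_sub_distrib, ← hsumw]
    refine Finset.sum_le_sum fun y _ => ?_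
    by_cases hy : y ∈ B
    · simp only [w, c, hy, if_true, and_true]
      have e : (((X \ W).filter (G.Adj y)).card : ℝ) =
          (X.filter (G.Adj y)).card - (W.filter (G.Adj y)).card := by
        rw [← Nat.cast_sub (Finset.card_le_card (Finset.filter_subset_filter _ hW)),
          ← Finset.card_sdiff_of_subset (Finset.filter_subset_filter _ hW)]
        congr 2
        ext z
        simp only [Finset.mem_filter, Finset.mem_sdiff]
        tauto
      refine le_min (sub_le_self _ (by positivity)) ?_
      rw [e]
      refine (pow_sub_pow_le_mul (Nat.cast_nonneg _) ?_ m).trans (le_of_eq ?_)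
      · exact_mod_cast Finset.card_le_card (Finset.filter_subset_filter _ hW)
      · rw [← Finset.sum_filter, Finset.sum_const, nsmul_eq_mul]
        simp only [G.adj_comm]
    · simp [w, c, hy]
  obtain ⟨g, hg0, hgc, hgw, hgR⟩ := exists_flow_of_hall X hR0
    (fun x y => by simp only [c]; split_ifs <;> positivity)
    (fun y => by simp only [w]; split_ifs <;> positivity) hall
  have hsupp : ∀ x y, g x y ≠ 0 → G.Adj x y ∧ y ∈ B := by
    intro x y hne
    by_contra h
    have := hgc x y
    simp only [c, h, if_false] at this
    exact hne (le_antisymm this (hg0 x y))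
  have hrow : ∀ x, ∑ y ∈ B, g x y = ∑ y, g x y := fun x =>
    Finset.sum_subset (Finset.subset_univ _) fun y _ hy => by
      by_contra h
      exact hy (hsupp x y h).2
  -- The rows carry R |X| = S X in total, which is the sum of the column bounds, so every column is
  -- saturated.
  have htot : ∑ y ∈ B, ∑ x ∈ X, g x y = ∑ y ∈ B, w y := by
    rw [Finset.sum_comm, Finset.sum_congr rfl fun x hx => (hrow x).trans (hgR x hx),
      Finset.sum_const, nsmul_eq_mul, mul_comm, hRX]
    exact Finset.sum_congr rfl fun y hy => by simp only [w, hy, if_true]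
  refine ⟨X, hXA, hXne, R, g, hle A subset_rfl, hg0, hsupp, fun x y => ?_, fun y hy => ?_,
    fun x hx => (hrow x).trans (hgR x hx)⟩
  · refine (hgc x y).trans ?_
    simp only [c]
    split_ifs
    exacts [le_rfl, by positivity]
  · have := (Finset.sum_eq_sum_iff_of_le fun y _ => hgw y).1 htot y hy
    simpa only [w, hy, if_true] using this

end SimpleGraph

/-! ### The initial nearly regular weighting. -/

namespace SimpleGraph

section Sampling

variable {V : Type*} [DecidableEq V] {G : SimpleGraph V}

/-- Sampling the vertices of `Y` with probabilities `p`, for which the expected weighted degrees of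
the vertices of `X` are close to `T`, gives a nearly regular weighting. -/
lemma hasNearRegularWeight_of_bipartite {X Y : Finset V} (hXY : Disjoint X Y) (hX : X.Nonempty)
    {k : V → V → ℝ} (hk0 : ∀ x y, 0 ≤ k x y) (hk1 : ∀ x y, k x y ≤ 1)
    (hk : ∀ x y, k x y ≠ 0 → G.Adj x y ∧ x ∈ X ∧ y ∈ Y) {p : V → ℝ} (hp0 : ∀ y ∈ Y, 0 ≤ p y)
    (hp1 : ∀ y ∈ Y, p y ≤ 1) {T : ℝ} (hT : 4000000 ≤ T) (hcol : ∀ y ∈ Y, ∑ x ∈ X, k x y = T)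
    (hlow : ∀ x ∈ X, T - 1 ≤ ∑ y ∈ Y, p y * k x y) (hupp : ∀ x ∈ X, ∑ y ∈ Y, p y * k x y ≤ T) :
    G.HasNearRegularWeight T (T / 100) (1 / 2) := by
  have hXc : (0 : ℝ) < X.card := by exact_mod_cast hX.card_pos
  -- One unit of the width T/100 is reserved for the gap between the mean and T.
  have htail : 2 / (1 / 400) * Real.exp (-(1 / 400 * (T / 100 - 1)) + (1 / 400) ^ 2 * T) < 1 / 2 := by
    set z := 1 / 400 * (T / 100 - 1) - (1 / 400) ^ 2 * T with hz
    have hz70 : 70 ≤ z := by rw [hz]; linarith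
    rw [show -(1 / 400 * (T / 100 - 1)) + (1 / 400) ^ 2 * T = -z by rw [hz]; ring, Real.exp_neg]
    have := Real.quadratic_le_exp_of_nonneg (show 0 ≤ z by linarith)
    have h2 : 1600 < Real.exp z := by nlinarith
    rw [← div_eq_mul_inv, div_lt_iff₀ (Real.exp_pos _)]
    linarith
  have hdev : ∀ x ∈ X, ∑ S ∈ Y.powerset, subsetWeight Y p S *
      max (|∑ y ∈ S, k x y - T| - T / 100) 0 < 1 / 2 := by
    intro x hx
    refine lt_of_le_of_lt ?_ htail
    refine le_trans (Finset.sum_le_sum fun S hS => ?_) (sum_subsetWeight_mul_deviation_le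
      (Λ := T / 100 - 1) hp0 hp1 (fun y _ => hk0 x y) (fun y _ => hk1 x y) (by norm_num) (by norm_num)
      (le_trans (Finset.sum_le_sum fun y hy => ?_) (hupp x hx)))
    · refine mul_le_mul_of_nonneg_left (max_le_max ?_ le_rfl)
        (subsetWeight_nonneg hp0 hp1 (Finset.mem_powerset.1 hS))
      have h1 := abs_sub_le (∑ y ∈ S, k x y) (∑ y ∈ Y, p y * k x y) T
      have h2 : |∑ y ∈ Y, p y * k x y - T| ≤ 1 :=
        abs_le.2 ⟨by linarith [hlow x hx], by linarith [hupp x hx]⟩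
      linarith
    · nlinarith [mul_nonneg (mul_nonneg (hp0 y hy) (hp0 y hy)) (hk0 x y)]
  obtain ⟨S, hSY, hS⟩ := exists_subset_neg_of_sum_neg (U := Y) (p := p)
    (F := fun S => ∑ x ∈ X, max (|∑ y ∈ S, k x y - T| - T / 100) 0 - 1 / 2 * X.card) hp0 hp1 (by
      simp only [mul_sub, Finset.sum_sub_distrib, ← Finset.sum_mul, sum_subsetWeight, one_mul]
      simp only [Finset.mul_sum]
      rw [Finset.sum_comm, sub_neg]
      refine (Finset.sum_lt_sum_of_nonempty hX hdev).trans_eq ?_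
      rw [Finset.sum_const, nsmul_eq_mul, mul_comm])
  have hXS : Disjoint X S := hXY.mono_right hSY
  have hzero : ∀ x y, ¬(x ∈ X ∧ y ∈ Y) → k x y = 0 := fun x y h => by
    by_contra hne
    exact h (hk x y hne).2
  have hnX : ∀ y ∈ Y, y ∉ X := fun y hy hyX => Finset.disjoint_left.1 hXY hyX hy
  refine ⟨X ∪ S, fun v w => k v w + k w v, hX.mono Finset.subset_union_left,
    ⟨fun v w => add_comm _ _, fun v w => add_nonneg (hk0 _ _) (hk0 _ _), fun v w => ?_,
      fun v w hne => ?_⟩, ?_⟩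
  · by_cases h : v ∈ X
    · rw [hzero w v fun h' => hnX v h'.2 h, add_zero]
      exact hk1 v w
    · rw [hzero v w fun h' => h h'.1, zero_add]
      exact hk1 w v
  · rcases eq_or_ne (k v w) 0 with h | h
    · rw [h, zero_add] at hne
      exact (hk w v hne).1.symm
    · exact (hk v w h).1
  · rw [Finset.sum_union hXS, Finset.card_union_of_disjoint hXS]
    -- All of X is kept, so sampled vertices of Y have degree exactly T; only X contributes excess.
    have h1 : ∀ v ∈ S, max (|∑ w ∈ X ∪ S, (k v w + k w v) - T| - T / 100) 0 = 0 := by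
      intro v hv
      have e : ∑ w ∈ X ∪ S, (k v w + k w v) = T := by
        rw [Finset.sum_union hXS, ← hcol v (hSY hv)]
        rw [Finset.sum_eq_zero (s := S) fun w hw => ?_, add_zero]
        · exact Finset.sum_congr rfl fun w _ => by
            rw [hzero v w fun h => hnX v (hSY hv) h.1, zero_add]
        · rw [hzero v w fun h => hnX v (hSY hv) h.1, hzero w v fun h => hnX w (hSY hw) h.1, add_zero]
      rw [e, sub_self, abs_zero]
      exact max_eq_right (by linarith)
    have h2 : ∀ v ∈ X, ∑ w ∈ X ∪ S, (k v w + k w v) = ∑ y ∈ S, k v y := by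
      intro v hv
      rw [Finset.sum_union hXS, Finset.sum_eq_zero (s := X) fun w hw => ?_, zero_add]
      · exact Finset.sum_congr rfl fun w _ => by
          rw [hzero w v fun h => hnX v h.2 hv, add_zero]
      · rw [hzero v w fun h => hnX w h.2 hw, hzero w v fun h => hnX v h.2 hv, add_zero]
    rw [Finset.sum_eq_zero h1, add_zero, Finset.sum_congr rfl fun v hv => by rw [h2 v hv]]
    push_cast
    have : (0 : ℝ) ≤ S.card := Nat.cast_nonneg _
    linarith

end Sampling

variable {V : Type*} [Fintype V] [DecidableEq V] {G : SimpleGraph V} [DecidableRel G.Adj]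

/-- The balanced flow g becomes the weighting g T / d^m, sampled with probabilities d^m / R. Columns
then sum to T, and the mean at x is T/R times its inflow from Y. The two density hypotheses give R ≥
s^m, so the probabilities are at most 1, and R ≥ D (s/2)^m, so dropping the y with d y < s/2 costs
at most 1. -/
lemma hasNearRegularWeight_of_density {A B : Finset V} (hAB : Disjoint A B) (hA : A.Nonempty)
    {m s : ℕ} (hm : m ≠ 0) (hs : s ≠ 0) {D : ℝ} (hT : 4000000 ≤ (s : ℝ) / (2 * m))
    (hB : ∀ y ∈ B, (A.filter (G.Adj y)).card = s)
    (hD : ∀ x ∈ A, ((B.filter (G.Adj x)).card : ℝ) ≤ D)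
    (hBA : (s : ℝ) ^ m * A.card ≤ (s : ℝ) ^ m * B.card)
    (hDBA : D * ((s : ℝ) / 2) ^ m * A.card ≤ (s : ℝ) ^ m * B.card) :
    G.HasNearRegularWeight ((s : ℝ) / (2 * m)) ((s : ℝ) / (2 * m) / 100) (1 / 2) := by
  obtain ⟨X, hXA, hX, R, g, hR, hg0, hgadj, hgle, hgcol, hgrow⟩ := G.exists_balanced_flow A B hA hm
  set T := (s : ℝ) / (2 * m) with hTdef
  have hs0 : (0 : ℝ) < s := by exact_mod_cast Nat.pos_of_ne_zero hs
  have hm0 : (0 : ℝ) < m := by exact_mod_cast Nat.pos_of_ne_zero hm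
  have hA0 : (0 : ℝ) < A.card := by exact_mod_cast hA.card_pos
  have hR' : (s : ℝ) ^ m * B.card ≤ R * A.card := by
    refine le_trans (le_of_eq ?_) hR
    rw [Finset.sum_congr rfl fun y hy => by rw [hB y hy], Finset.sum_const, nsmul_eq_mul, mul_comm]
  have hRs : (s : ℝ) ^ m ≤ R := le_of_mul_le_mul_right (hBA.trans hR') hA0
  have hRD : D * ((s : ℝ) / 2) ^ m ≤ R := le_of_mul_le_mul_right (hDBA.trans hR') hA0
  have hR0 : 0 < R := (pow_pos hs0 m).trans_le hRs
  set d : V → ℝ := fun y => ((X.filter (G.Adj y)).card : ℝ) with hd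
  have hd0 : ∀ y, 0 ≤ d y := fun y => Nat.cast_nonneg _
  have hds : ∀ y ∈ B, d y ≤ s := fun y hy => by
    rw [← hB y hy]
    exact Nat.cast_le.2 (Finset.card_le_card (Finset.filter_subset_filter _ hXA))
  set Y := B.filter fun y => (s : ℝ) / 2 ≤ d y with hY
  have hYB : Y ⊆ B := Finset.filter_subset _ _
  have hdY : ∀ y ∈ Y, (s : ℝ) / 2 ≤ d y := fun y hy => (Finset.mem_filter.1 hy).2
  have hdY0 : ∀ y ∈ Y, 0 < d y := fun y hy => (half_pos hs0).trans_le (hdY y hy)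
  obtain ⟨n, hn⟩ := Nat.exists_eq_succ_of_ne_zero hm
  have hpow : ∀ z : ℝ, z ^ m = z ^ (m - 1) * z := fun z => by
    rw [hn, Nat.succ_sub_one, pow_succ]
  have hterm : ∀ x, ∀ y ∈ Y, d y ^ m / R * (g x y * T / d y ^ m) = T / R * g x y := by
    intro x y hy
    have := (pow_pos (hdY0 y hy) m).ne'
    field_simp
  have hT0 : 0 ≤ T := by positivity
  have hmean : ∀ x, ∑ y ∈ Y, d y ^ m / R * (if x ∈ X ∧ y ∈ Y then g x y * T / d y ^ m else 0) =
      if x ∈ X then T / R * ∑ y ∈ Y, g x y else 0 := by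
    intro x
    split_ifs with hx
    · rw [Finset.mul_sum]
      exact Finset.sum_congr rfl fun y hy => by rw [if_pos ⟨hx, hy⟩, hterm x y hy]
    · exact Finset.sum_eq_zero fun y _ => by rw [if_neg fun h => hx h.1, mul_zero]
  refine hasNearRegularWeight_of_bipartite (X := X) (Y := Y)
    (k := fun x y => if x ∈ X ∧ y ∈ Y then g x y * T / d y ^ m else 0) (p := fun y => d y ^ m / R)
    (hAB.mono hXA hYB) hX (fun x y => ?_) (fun x y => ?_) (fun x y h => ?_) (fun y _ => ?_)
    (fun y hy => ?_) hT (fun y hy => ?_) (fun x hx => ?_) fun x hx => ?_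
  · split_ifs
    · exact div_nonneg (mul_nonneg (hg0 x y) hT0) (pow_nonneg (hd0 y) m)
    · exact le_rfl
  · split_ifs with h
    · rw [div_le_one (pow_pos (hdY0 y h.2) m)]
      have h1 := hgle x y
      -- This fixes T = s/(2m): with the capacity m d^(m-1) it keeps the weights at most 1.
      have h2 : m * T ≤ d y := by
        refine le_trans (le_of_eq ?_) (hdY y h.2)
        rw [hTdef]; field_simp
      calc g x y * T ≤ m * d y ^ (m - 1) * T := mul_le_mul_of_nonneg_right h1 hT0
        _ = d y ^ (m - 1) * (m * T) := by ring
        _ ≤ d y ^ (m - 1) * d y := mul_le_mul_of_nonneg_left h2 (pow_nonneg (hd0 y) _)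
        _ = d y ^ m := (hpow _).symm
    · exact zero_le_one
  · obtain ⟨h1, h2⟩ := ite_ne_right_iff.1 h
    refine ⟨(hgadj x y fun h0 => h2 ?_).1, h1⟩
    rw [h0, zero_mul, zero_div]
  · exact div_nonneg (pow_nonneg (hd0 y) m) hR0.le
  · exact (div_le_one hR0).2 ((pow_le_pow_left₀ (hd0 y) (hds y (hYB hy)) m).trans hRs)
  · rw [Finset.sum_congr rfl fun x hx => if_pos ⟨hx, hy⟩, ← Finset.sum_div, ← Finset.sum_mul,
      hgcol y (hYB hy), mul_comm]
    exact mul_div_cancel_right₀ _ (pow_pos (hdY0 y hy) m).ne'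
  · rw [hmean, if_pos hx]
    have hsplit := Finset.sum_filter_add_sum_filter_not B (fun y => (s : ℝ) / 2 ≤ d y) (g x)
    rw [hgrow x hx] at hsplit
    -- At most D edges at x, each with capacity at most m (s/2)^(m-1).
    have hlossy : ∑ y ∈ B with ¬(s : ℝ) / 2 ≤ d y, g x y ≤ D * (m * ((s : ℝ) / 2) ^ (m - 1)) := by
      refine le_trans ?_ (mul_le_mul_of_nonneg_right (hD x (hXA hx)) (by positivity))
      rw [← nsmul_eq_mul, ← Finset.sum_const]
      refine le_trans (Finset.sum_le_sum (g := fun y => if G.Adj x y then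
        m * ((s : ℝ) / 2) ^ (m - 1) else 0) fun y hy => ?_) ?_
      · split_ifs with h
        · refine (hgle x y).trans (mul_le_mul_of_nonneg_left ?_ hm0.le)
          exact pow_le_pow_left₀ (hd0 y) (not_le.1 (Finset.mem_filter.1 hy).2).le _
        · by_contra hne
          exact h (hgadj x y fun h0 => hne h0.le).1
      · rw [Finset.sum_filter (p := G.Adj x)]
        exact Finset.sum_le_sum_of_subset_of_nonneg (Finset.filter_subset _ _) fun y _ _ =>
          ite_nonneg (by positivity) le_rfl
    have e : D * (m * ((s : ℝ) / 2) ^ (m - 1)) * T = D * ((s : ℝ) / 2) ^ m := by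
      rw [hTdef, hpow]
      field_simp
    have h3 : R * T - R ≤ (∑ y ∈ Y, g x y) * T := by
      have : (∑ y ∈ B with ¬(s : ℝ) / 2 ≤ d y, g x y) * T ≤ R :=
        (mul_le_mul_of_nonneg_right hlossy hT0).trans (e.le.trans hRD)
      rw [← hsplit, add_mul]
      rw [← hsplit] at this
      linarith
    rw [div_mul_eq_mul_div, le_div_iff₀ hR0]
    linarith
  · rw [hmean, if_pos hx, div_mul_eq_mul_div, div_le_iff₀ hR0]
    refine mul_le_mul_of_nonneg_left ?_ hT0
    rw [← hgrow x hx]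
    exact Finset.sum_le_sum_of_subset_of_nonneg hYB fun y _ _ => hg0 x y

end SimpleGraph

/-! ### Integrality of bipartite degree-constrained polytopes. -/

section Rounding

variable {α β : Type*} [Fintype α] [Fintype β] [DecidableEq α] [DecidableEq β]

/-- A linear system with more unknowns (cells) than equations (rows and columns) has a non-zero
solution. -/
lemma exists_zero_sums_of_card_lt (F : Finset (α × β)) (R : Finset α) (C : Finset β)
    (h : R.card + C.card < F.card) :
    ∃ δ : α → β → ℝ, (∃ a b, δ a b ≠ 0) ∧ (∀ a b, (a, b) ∉ F → δ a b = 0) ∧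
      (∀ a ∈ R, ∑ b, δ a b = 0) ∧ ∀ b ∈ C, ∑ a, δ a b = 0 := by
  let ext : (F → ℝ) →ₗ[ℝ] (α → β → ℝ) :=
    { toFun := fun x a b => if hab : (a, b) ∈ F then x ⟨(a, b), hab⟩ else 0
      map_add' := fun x y => by
        ext a b; simp only [Pi.add_apply]; split_ifs <;> simp
      map_smul' := fun t x => by
        ext a b; simp only [Pi.smul_apply, RingHom.id_apply]; split_ifs <;> simp }
  let sums : (α → β → ℝ) →ₗ[ℝ] (R → ℝ) × (C → ℝ) :=
    { toFun := fun g => (fun a => ∑ b, g a b, fun b => ∑ a, g a b)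
      map_add' := fun x y => by
        ext <;> simp [Finset.sum_add_distrib]
      map_smul' := fun t x => by
        ext <;> simp [Finset.mul_sum] }
  have hrank : Module.finrank ℝ ((R → ℝ) × (C → ℝ)) < Module.finrank ℝ (F → ℝ) := by
    simpa [Module.finrank_prod] using h
  obtain ⟨x, hx, hx0⟩ := Submodule.exists_mem_ne_zero_of_ne_bot
    (LinearMap.ker_ne_bot_of_finrank_lt (f := sums ∘ₗ ext) hrank)
  rw [LinearMap.mem_ker, LinearMap.comp_apply] at hx
  have hx1 := congrArg Prod.fst hx
  have hx2 := congrArg Prod.snd hx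
  refine ⟨ext x, ?_, fun a b hab => dif_neg hab, fun a ha => congrFun hx1 ⟨a, ha⟩,
    fun b hb => congrFun hx2 ⟨b, hb⟩⟩
  obtain ⟨⟨⟨a, b⟩, he⟩, hne⟩ := Function.ne_iff.1 hx0
  exact ⟨a, b, by simpa [ext, he] using hne⟩

/-- A non-empty set of cells in which no row of `R` and no column of `C` contains exactly one cell
supports a non-zero matrix whose row sums over `R` and column sums over `C` vanish. -/
lemma exists_zero_sums (F : Finset (α × β)) (hF : F.Nonempty) (R : Finset α) (C : Finset β)
    (hR : ∀ a ∈ R, (F.filter fun e => e.1 = a).card ≠ 1)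
    (hC : ∀ b ∈ C, (F.filter fun e => e.2 = b).card ≠ 1) :
    ∃ δ : α → β → ℝ, (∃ a b, δ a b ≠ 0) ∧ (∀ a b, (a, b) ∉ F → δ a b = 0) ∧
      (∀ a ∈ R, ∑ b, δ a b = 0) ∧ ∀ b ∈ C, ∑ a, δ a b = 0 := by
  set R' := R.filter fun a => (F.filter fun e => e.1 = a).card ≠ 0 with hR'
  set C' := C.filter fun b => (F.filter fun e => e.2 = b).card ≠ 0 with hC'
  have hR2 : ∀ a ∈ R', 2 ≤ (F.filter fun e => e.1 = a).card := fun a ha => by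
    obtain ⟨h1, h2⟩ := Finset.mem_filter.1 ha
    have := hR a h1
    omega
  have hC2 : ∀ b ∈ C', 2 ≤ (F.filter fun e => e.2 = b).card := fun b hb => by
    obtain ⟨h1, h2⟩ := Finset.mem_filter.1 hb
    have := hC b h1
    omega
  have sumR : (F.filter fun e => e.1 ∈ R').card = ∑ a ∈ R', (F.filter fun e => e.1 = a).card := by
    refine (Finset.card_eq_sum_card_fiberwise (f := fun e : α × β => e.1) (t := R')
      fun e he => (Finset.mem_filter.1 he).2).trans ?_
    refine Finset.sum_congr rfl fun a ha => ?_
    rw [Finset.filter_filter]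
    congr 1
    exact Finset.filter_congr fun e _ => ⟨fun h => h.2, fun h => ⟨Set.mem_of_eq_of_mem h ha, h⟩⟩
  have sumC : (F.filter fun e => e.2 ∈ C').card = ∑ b ∈ C', (F.filter fun e => e.2 = b).card := by
    refine (Finset.card_eq_sum_card_fiberwise (f := fun e : α × β => e.2) (t := C')
      fun e he => (Finset.mem_filter.1 he).2).trans ?_
    refine Finset.sum_congr rfl fun b hb => ?_
    rw [Finset.filter_filter]
    congr 1
    exact Finset.filter_congr fun e _ => ⟨fun h => h.2, fun h => ⟨Set.mem_of_eq_of_mem h hb, h⟩⟩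
  have lowR := Finset.card_nsmul_le_sum R' _ 2 hR2
  have lowC := Finset.card_nsmul_le_sum C' _ 2 hC2
  have leR := Finset.card_filter_le F fun e => e.1 ∈ R'
  have leC := Finset.card_filter_le F fun e => e.2 ∈ C'
  rw [← sumR, smul_eq_mul] at lowR
  rw [← sumC, smul_eq_mul] at lowC
  have restR : ∀ δ : α → β → ℝ, (∀ a b, (a, b) ∉ F → δ a b = 0) → ∀ a ∈ R, a ∉ R' →
      ∑ b, δ a b = 0 := fun δ hδ a ha haR' => by
    refine Finset.sum_eq_zero fun b _ => hδ a b fun hab => haR' (Finset.mem_filter.2 ⟨ha, ?_⟩)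
    exact (Finset.card_pos.2 (show (F.filter fun e => e.1 = a).Nonempty from
      ⟨(a, b), Finset.mem_filter.2 ⟨hab, rfl⟩⟩)).ne'
  have restC : ∀ δ : α → β → ℝ, (∀ a b, (a, b) ∉ F → δ a b = 0) → ∀ b ∈ C, b ∉ C' →
      ∑ a, δ a b = 0 := fun δ hδ b hb hbC' => by
    refine Finset.sum_eq_zero fun a _ => hδ a b fun hab => hbC' (Finset.mem_filter.2 ⟨hb, ?_⟩)
    exact (Finset.card_pos.2 (show (F.filter fun e => e.2 = b).Nonempty from
      ⟨(a, b), Finset.mem_filter.2 ⟨hab, rfl⟩⟩)).ne'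
  rcases lt_or_ge (R'.card + C'.card) F.card with hlt | hge
  · obtain ⟨δ, h0, h1, h2, h3⟩ := exists_zero_sums_of_card_lt F R' C' hlt
    refine ⟨δ, h0, h1, fun a ha => ?_, fun b hb => ?_⟩
    · by_cases h : a ∈ R'
      exacts [h2 a h, restR δ h1 a ha h]
    · by_cases h : b ∈ C'
      exacts [h3 b h, restC δ h1 b hb h]
  -- As 2|R'| ≤ |F| and 2|C'| ≤ |F|, here equality holds and every cell lies in R' × C'. Row sums
  -- and column sums have the same total, so one row equation is redundant and can be dropped.
  · have allR : ∀ e ∈ F, e.1 ∈ R' :=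
      Finset.filter_eq_self.1 (Finset.eq_of_subset_of_card_le (Finset.filter_subset _ _) (by omega))
    have allC : ∀ e ∈ F, e.2 ∈ C' :=
      Finset.filter_eq_self.1 (Finset.eq_of_subset_of_card_le (Finset.filter_subset _ _) (by omega))
    obtain ⟨e₀, he₀⟩ := hF
    have hcard := Finset.card_pos.2 ⟨e₀, he₀⟩
    have hmem := allR e₀ he₀
    obtain ⟨δ, h0, h1, h2, h3⟩ := exists_zero_sums_of_card_lt F (R'.erase e₀.1) C' (by
      rw [Finset.card_erase_of_mem hmem]
      have := Finset.card_pos.2 ⟨_, hmem⟩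
      omega)
    have hcols : ∀ b, ∑ a, δ a b = 0 := fun b => by
      by_cases h : b ∈ C'
      · exact h3 b h
      · exact Finset.sum_eq_zero fun a _ => h1 a b fun hab => h (allC _ hab)
    have hrows : ∀ a, a ≠ e₀.1 → ∑ b, δ a b = 0 := fun a ha => by
      by_cases h : a ∈ R'
      · exact h2 a (Finset.mem_erase.2 ⟨ha, h⟩)
      · exact Finset.sum_eq_zero fun b _ => h1 a b fun hab => h (allR _ hab)
    refine ⟨δ, h0, h1, fun a _ => ?_, fun b _ => hcols b⟩
    rcases eq_or_ne a e₀.1 with rfl | ha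
    · rw [← Finset.sum_eq_single (s := Finset.univ) (f := fun a => ∑ b, δ a b) e₀.1
        (fun a _ ha => hrows a ha) (by simp), Finset.sum_comm]
      exact Finset.sum_eq_zero fun b _ => hcols b
    · exact hrows a ha

/-- If all entries of `x` but one are integers, then so is the last one as soon as the sum is. -/
lemma card_fractional_ne_one {ι : Type*} [Fintype ι] [DecidableEq ι] {x : ι → ℝ} {k : ℕ}
    (h0 : ∀ i, 0 ≤ x i) (h1 : ∀ i, x i ≤ 1) (hk : ∑ i, x i = k) :
    (Finset.univ.filter fun i => 0 < x i ∧ x i < 1).card ≠ 1 := by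
  intro h
  obtain ⟨j, hj⟩ := Finset.card_eq_one.1 h
  have hjm : 0 < x j ∧ x j < 1 := by
    have : j ∈ Finset.univ.filter fun i => 0 < x i ∧ x i < 1 := by simp [hj]
    simpa using this
  have hother : ∀ i ∈ Finset.univ.erase j, x i = ((if x i = 1 then 1 else 0 : ℕ) : ℝ) := by
    intro i hi
    have hne := Finset.ne_of_mem_erase hi
    have : i ∉ Finset.univ.filter fun i => 0 < x i ∧ x i < 1 := by simpa [hj] using hne
    simp only [Finset.mem_filter, Finset.mem_univ, true_and, not_and, not_lt] at this
    split_ifs with h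
    · simp [h]
    · rcases (h0 i).eq_or_lt with h' | h'
      · simp [← h']
      · exact absurd (le_antisymm (h1 i) (this h')) h
  rw [← Finset.add_sum_erase _ _ (Finset.mem_univ j), Finset.sum_congr rfl hother,
    ← Nat.cast_sum] at hk
  set n := ∑ i ∈ Finset.univ.erase j, if x i = 1 then 1 else 0
  have h2 : (n : ℝ) < k := by linarith
  have h3 : (k : ℝ) < n + 1 := by linarith
  have h4 : n < k := by exact_mod_cast h2
  have h5 : k < n + 1 := by exact_mod_cast h3
  omega

/-- Integrality of the bipartite `k`-matching polytope. -/
lemma exists_integral_matching {f : α → β → ℝ} (hf0 : ∀ a b, 0 ≤ f a b) (hf1 : ∀ a b, f a b ≤ 1)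
    {k : ℕ} (hrow : ∀ a, ∑ b, f a b ≤ k) (hcol : ∀ b, ∑ a, f a b ≤ k) :
    ∃ F : Finset (α × β), (∀ e ∈ F, f e.1 e.2 ≠ 0) ∧
      (∀ a, (F.filter fun e => e.1 = a).card ≤ k) ∧ (∀ b, (F.filter fun e => e.2 = b).card ≤ k) ∧
      ∑ a, ∑ b, f a b ≤ F.card := by
  classical
  -- The upper bound u confines the rounded matching to the support of f.
  set u : α → β → ℝ := fun a b => if f a b = 0 then 0 else 1 with hu
  have hu1 : ∀ a b, u a b ≤ 1 := fun a b => by simp only [hu]; split_ifs <;> norm_num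
  set P : Set (α → β → ℝ) := Set.Icc 0 u ∩
    ({g | ∀ a, ∑ b, g a b ≤ k} ∩ {g | ∀ b, ∑ a, g a b ≤ k}) with hP
  have hPc : IsCompact P := by
    refine isCompact_Icc.inter_right (IsClosed.inter ?_ ?_) <;> simp only [Set.ofPred_forall] <;>
    exact isClosed_iInter fun y => isClosed_le (by fun_prop) continuous_const
  have hfP : f ∈ P := by
    refine ⟨⟨hf0, fun a b => ?_⟩, hrow, hcol⟩
    simp only [hu]
    split_ifs with h
    exacts [h.le, hf1 a b]
  have hcont : Continuous fun g : α → β → ℝ => ∑ a, ∑ b, g a b := by fun_prop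
  obtain ⟨g₀, hg₀, hmax⟩ := hPc.exists_isMaxOn ⟨f, hfP⟩ hcont.continuousOn
  set M : Set (α → β → ℝ) := P ∩ {g | ∑ a, ∑ b, g₀ a b ≤ ∑ a, ∑ b, g a b} with hM
  have hMc : IsCompact M := hPc.inter_right (isClosed_le continuous_const hcont)
  -- An extreme point of the face of maximisers. A fractional cell would allow moving both ways
  -- along some δ that vanishes on all tight row and column sums.
  obtain ⟨x, hxM, hext⟩ := hMc.extremePoints_nonempty ⟨g₀, hg₀, le_refl (∑ a, ∑ b, g₀ a b)⟩
  obtain ⟨⟨⟨hx0, hxu⟩, hxr, hxc⟩, hxs⟩ := hxM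
  have hx1 : ∀ a b, x a b ≤ 1 := fun a b => (hxu a b).trans (hu1 a b)
  set Fr : Finset (α × β) := Finset.univ.filter fun e => 0 < x e.1 e.2 ∧ x e.1 e.2 < 1 with hFr
  have hint : Fr = ∅ := by
    by_contra hne
    obtain ⟨δ, ⟨a₀, b₀, hδ0⟩, hδF, hδr, hδc⟩ := exists_zero_sums Fr
      (Finset.nonempty_iff_ne_empty.2 hne) (Finset.univ.filter fun a => ∑ b, x a b = k)
      (Finset.univ.filter fun b => ∑ a, x a b = k)
      (fun a ha => by
        have := card_fractional_ne_one (x := x a) (fun b => hx0 a b) (hx1 a)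
          (Finset.mem_filter.1 ha).2
        intro h
        refine this (Eq.trans ?_ h)
        refine Finset.card_bij (fun b _ => (a, b)) (fun b hb => ?_) (fun _ _ _ _ h => (Prod.ext_iff.1 h).2)
          fun e he => ?_
        · simpa [hFr] using hb
        · obtain ⟨a', b⟩ := e
          simp only [hFr, Finset.mem_filter, Finset.mem_univ, true_and] at he
          obtain ⟨he, rfl⟩ := he
          exact ⟨b, by simpa using he, rfl⟩)
      (fun b hb => by
        have := card_fractional_ne_one (x := fun a => x a b) (fun a => hx0 a b) (fun a => hx1 a b)
          (Finset.mem_filter.1 hb).2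
        intro h
        refine this (Eq.trans ?_ h)
        refine Finset.card_bij (fun a _ => (a, b)) (fun a ha => ?_) (fun _ _ _ _ h => (Prod.ext_iff.1 h).1)
          fun e he => ?_
        · simpa [hFr] using ha
        · obtain ⟨a, b'⟩ := e
          simp only [hFr, Finset.mem_filter, Finset.mem_univ, true_and] at he
          obtain ⟨he, rfl⟩ := he
          exact ⟨a, by simpa using he, rfl⟩)
    have hev : ∀ᶠ t in nhds (0 : ℝ), x + t • δ ∈ P := by
      have hlim : ∀ (c d : ℝ), Filter.Tendsto (fun t : ℝ => c + t * d) (nhds 0) (nhds c) :=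
        fun c d => by
          have : Continuous fun t : ℝ => c + t * d := by fun_prop
          simpa using this.tendsto 0
      have hent : ∀ a b, ∀ᶠ t in nhds (0 : ℝ), 0 ≤ x a b + t * δ a b ∧ x a b + t * δ a b ≤ u a b := by
        intro a b
        by_cases hab : (a, b) ∈ Fr
        · have hab' : 0 < x a b ∧ x a b < 1 := by simpa [hFr] using hab
          have hu' : u a b = 1 := by
            have := hab'.1.trans_le (hxu a b)
            simp only [hu] at this ⊢
            split_ifs at this ⊢ with h
            · exact absurd this (lt_irrefl _)
            · rfl
          rw [hu']
          filter_upwards [(hlim (x a b) (δ a b)).eventually (lt_mem_nhds hab'.1),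
            (hlim (x a b) (δ a b)).eventually (gt_mem_nhds hab'.2)] with t h1 h2
          exact ⟨h1.le, h2.le⟩
        · rw [hδF a b hab]
          exact Filter.Eventually.of_forall fun t => by
            rw [mul_zero, add_zero]
            exact ⟨hx0 a b, hxu a b⟩
      have hr : ∀ a, ∀ᶠ t in nhds (0 : ℝ), ∑ b, (x a b + t * δ a b) ≤ k := by
        intro a
        simp only [Finset.sum_add_distrib, ← Finset.mul_sum]
        rcases (hxr a).eq_or_lt with h | h
        · rw [hδr a (by simpa using h)]
          exact Filter.Eventually.of_forall fun t => by rw [mul_zero, add_zero]; exact h.le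
        · exact ((hlim _ _).eventually (gt_mem_nhds h)).mono fun t ht => ht.le
      have hc : ∀ b, ∀ᶠ t in nhds (0 : ℝ), ∑ a, (x a b + t * δ a b) ≤ k := by
        intro b
        simp only [Finset.sum_add_distrib, ← Finset.mul_sum]
        rcases (hxc b).eq_or_lt with h | h
        · rw [hδc b (by simpa using h)]
          exact Filter.Eventually.of_forall fun t => by rw [mul_zero, add_zero]; exact h.le
        · exact ((hlim _ _).eventually (gt_mem_nhds h)).mono fun t ht => ht.le
      filter_upwards [Filter.eventually_all.2 fun a => Filter.eventually_all.2 (hent a),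
        Filter.eventually_all.2 hr, Filter.eventually_all.2 hc] with t h1 h2 h3
      exact ⟨⟨fun a b => (h1 a b).1, fun a b => (h1 a b).2⟩, h2, h3⟩
    have hev' : ∀ᶠ t in nhds (0 : ℝ), x + (-t) • δ ∈ P := by
      have : Filter.Tendsto (fun t : ℝ => -t) (nhds 0) (nhds 0) := by
        simpa using (continuous_neg (G := ℝ)).tendsto 0
      exact this.eventually hev
    obtain ⟨t, ⟨ht1, ht2⟩, ht0⟩ :=
      (((hev.and hev').filter_mono nhdsWithin_le_nhds).and
        (self_mem_nhdsWithin (s := Set.Ioi (0 : ℝ)))).exists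
    have ht0 : 0 < t := ht0
    have hsum : ∀ s : ℝ, ∑ a, ∑ b, (x + s • δ) a b = ∑ a, ∑ b, x a b + s * ∑ a, ∑ b, δ a b := by
      intro s
      simp [Finset.sum_add_distrib, Finset.mul_sum]
    have m1 : ∑ a, ∑ b, (x + t • δ) a b ≤ ∑ a, ∑ b, g₀ a b := hmax ht1
    have m2 : ∑ a, ∑ b, (x + (-t) • δ) a b ≤ ∑ a, ∑ b, g₀ a b := hmax ht2
    have hxs' : ∑ a, ∑ b, g₀ a b ≤ ∑ a, ∑ b, x a b := hxs
    rw [hsum] at m1 m2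
    -- Neither direction can increase the maximum, so both perturbed points stay in the face M.
    have hz : t * ∑ a, ∑ b, δ a b = 0 := by linarith
    have k1 : x + t • δ ∈ M := ⟨ht1, by
      change _ ≤ ∑ a, ∑ b, (x + t • δ) a b
      rw [hsum]; linarith⟩
    have k2 : x + (-t) • δ ∈ M := ⟨ht2, by
      change _ ≤ ∑ a, ∑ b, (x + (-t) • δ) a b
      rw [hsum]; linarith⟩
    have := hext k1 k2 ⟨1 / 2, 1 / 2, by norm_num, by norm_num, by norm_num, by
      ext a b
      simp only [Pi.add_apply, Pi.smul_apply, smul_eq_mul]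
      ring⟩
    have := congrFun (congrFun this a₀) b₀
    simp only [Pi.add_apply, Pi.smul_apply, smul_eq_mul, add_eq_left, mul_eq_zero] at this
    exact this.elim ht0.ne' hδ0
  have hval : ∀ a b, x a b = ((if 0 < x a b then 1 else 0 : ℕ) : ℝ) := by
    intro a b
    have : (a, b) ∉ Fr := by simp [hint]
    simp only [hFr, Finset.mem_filter, Finset.mem_univ, true_and, not_and, not_lt] at this
    split_ifs with h
    · rw [Nat.cast_one]; exact le_antisymm (hx1 a b) (this h)
    · rw [Nat.cast_zero]; exact le_antisymm (not_lt.1 h) (hx0 a b)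
  set F : Finset (α × β) := Finset.univ.filter fun e => 0 < x e.1 e.2 with hF
  have hcardr : ∀ a, ((F.filter fun e => e.1 = a).card : ℝ) = ∑ b, x a b := by
    intro a
    rw [Finset.sum_congr rfl fun b _ => hval a b, ← Nat.cast_sum, ← Finset.card_filter]
    congr 1
    symm
    refine Finset.card_bij (fun b _ => (a, b)) (fun b hb => ?_) (fun _ _ _ _ h => (Prod.ext_iff.1 h).2)
      fun e he => ?_
    · simpa [hF] using hb
    · obtain ⟨a', b⟩ := e
      simp only [hF, Finset.mem_filter, Finset.mem_univ, true_and] at he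
      obtain ⟨he, rfl⟩ := he
      exact ⟨b, by simpa using he, rfl⟩
  have hcardc : ∀ b, ((F.filter fun e => e.2 = b).card : ℝ) = ∑ a, x a b := by
    intro b
    rw [Finset.sum_congr rfl fun a _ => hval a b, ← Nat.cast_sum, ← Finset.card_filter]
    congr 1
    symm
    refine Finset.card_bij (fun a _ => (a, b)) (fun a ha => ?_) (fun _ _ _ _ h => (Prod.ext_iff.1 h).1)
      fun e he => ?_
    · simpa [hF] using ha
    · obtain ⟨a, b'⟩ := e
      simp only [hF, Finset.mem_filter, Finset.mem_univ, true_and] at he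
      obtain ⟨he, rfl⟩ := he
      exact ⟨a, by simpa using he, rfl⟩
  refine ⟨F, fun e he h0 => ?_, fun a => ?_, fun b => ?_, ?_⟩
  · have h1 : 0 < x e.1 e.2 := by simpa [hF] using he
    have h2 := h1.trans_le (hxu e.1 e.2)
    simp [hu, h0] at h2
  · exact_mod_cast (hcardr a).le.trans (hxr a)
  · exact_mod_cast (hcardc b).le.trans (hxc b)
  · have e1 : (F.card : ℝ) = ∑ a, ∑ b, x a b := by
      rw [Finset.card_eq_sum_card_fiberwise (t := Finset.univ) (f := Prod.fst) (fun e _ => by simp),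
        Nat.cast_sum]
      exact Finset.sum_congr rfl fun a _ => hcardr a
    rw [e1]
    exact le_trans (hmax hfP) hxs

end Rounding

/-! ### Regular subgraphs via Chevalley–Warning. -/

/-- **Alon-Friedland-Kalai**, for bipartite graphs: if all degrees are at most `2q - 1`, where `q` is
a prime, and the average degree is greater than `2(q - 1)`, then there is a `q`-regular subgraph. -/
lemma exists_regular_of_prime {α β : Type*} [DecidableEq α] [DecidableEq β]
    {q : ℕ} (hq : q.Prime) {R : Finset α} {C : Finset β} {F : Finset (α × β)} (hRC : F ⊆ R ×ˢ C)
    (hrow : ∀ a, (F.filter fun e => e.1 = a).card < 2 * q)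
    (hcol : ∀ b, (F.filter fun e => e.2 = b).card < 2 * q)
    (hF : (q - 1) * (R.card + C.card) < F.card) :
    ∃ F' ⊆ F, F'.Nonempty ∧ (∀ e ∈ F', (F'.filter fun e' => e'.1 = e.1).card = q) ∧
      ∀ e ∈ F', (F'.filter fun e' => e'.2 = e.2).card = q := by
  classical
  have : Fact q.Prime := ⟨hq⟩
  let D : R ⊕ C → Finset F := Sum.elim (fun a => Finset.univ.filter fun e => e.1.1 = a.1)
    fun b => Finset.univ.filter fun e => e.1.2 = b.1
  -- One variable per edge and one polynomial per vertex. By Fermat, the value at x counts modulo q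
  -- the edges at the vertex where x is non-zero, so the support of a non-trivial common zero has
  -- degrees divisible by q and below 2q.
  let P : R ⊕ C → MvPolynomial F (ZMod q) := fun i => ∑ e ∈ D i, MvPolynomial.X e ^ (q - 1)
  have hdeg : ∀ i, (P i).totalDegree ≤ q - 1 := fun i =>
    MvPolynomial.totalDegree_finsetSum_le fun e _ => by
      rw [MvPolynomial.totalDegree_X_pow]
  have hsum : ∑ i ∈ Finset.univ, (P i).totalDegree < Fintype.card F := by
    refine lt_of_le_of_lt (Finset.sum_le_card_nsmul _ _ _ fun i _ => hdeg i) ?_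
    rw [Fintype.card_coe, Finset.card_univ, Fintype.card_sum, Fintype.card_coe, Fintype.card_coe,
      smul_eq_mul, mul_comm]
    exact hF
  have hdvd := char_dvd_card_solutions_of_sum_lt q hsum
  have hzero : ∀ i ∈ Finset.univ, MvPolynomial.eval (0 : F → ZMod q) (P i) = 0 := fun i _ => by
    have : q - 1 ≠ 0 := by have := hq.two_le; omega
    simp [P, this]
  have hcard : 1 < Fintype.card
      {x : F → ZMod q // ∀ i ∈ Finset.univ, MvPolynomial.eval x (P i) = 0} :=
    lt_of_lt_of_le hq.one_lt (Nat.le_of_dvd (Fintype.card_pos_iff.2 ⟨⟨0, hzero⟩⟩) (by convert hdvd))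
  obtain ⟨⟨x, hx⟩, hne⟩ := Fintype.exists_ne_of_one_lt_card hcard ⟨0, hzero⟩
  have hx0 : x ≠ 0 := fun h => hne (Subtype.ext h)
  have hcount : ∀ i, q ∣ ((D i).filter fun e => x e ≠ 0).card := by
    intro i
    have := hx i (Finset.mem_univ i)
    simp only [P, map_sum, map_pow, MvPolynomial.eval_X] at this
    rw [← ZMod.natCast_eq_zero_iff, Finset.card_filter, Nat.cast_sum]
    refine Eq.trans ?_ this
    refine Finset.sum_congr rfl fun e _ => ?_
    split_ifs with h
    · rw [ZMod.pow_card_sub_one_eq_one h, Nat.cast_one]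
    · have : q - 1 ≠ 0 := by have := hq.two_le; omega
      rw [not_not.1 h, zero_pow this, Nat.cast_zero]
  set F' : Finset (α × β) :=
    (Finset.univ.filter fun e : F => x e ≠ 0).map (Function.Embedding.subtype _) with hF'
  have hF'F : F' ⊆ F := fun e he => by
    obtain ⟨e', -, rfl⟩ := Finset.mem_map.1 he
    exact e'.2
  have key : ∀ (s : α × β → Prop) [DecidablePred s] (i : R ⊕ C),
      (∀ e : F, e ∈ D i ↔ s e.1) → (F.filter s).card < 2 * q →
      ∀ e ∈ F', s e → (F'.filter s).card = q := by
    intro s _ i hi hlt e he hse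
    have e1 : (F'.filter s).card = ((D i).filter fun e => x e ≠ 0).card := by
      rw [hF', Finset.filter_map, Finset.card_map]
      congr 1
      ext e
      simp [hi, and_comm]
    obtain ⟨k, hk⟩ := hcount i
    rw [← e1] at hk
    have h1 : (F'.filter s).card < 2 * q :=
      (Finset.card_le_card (Finset.filter_subset_filter _ hF'F)).trans_lt hlt
    have h2 : 0 < (F'.filter s).card := Finset.card_pos.2 ⟨e, Finset.mem_filter.2 ⟨he, hse⟩⟩
    rw [hk] at h1 h2 ⊢
    have hk2 : k < 2 := by nlinarith
    have hk0 : 0 < k := Nat.pos_of_mul_pos_left h2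
    have : k = 1 := by omega
    rw [this, mul_one]
  refine ⟨F', hF'F, ?_, fun e he => ?_, fun e he => ?_⟩
  · obtain ⟨e, he⟩ := Function.ne_iff.1 hx0
    exact ⟨e.1, Finset.mem_map.2 ⟨e, by simpa using he, rfl⟩⟩
  · exact key (fun e' => e'.1 = e.1) (Sum.inl ⟨e.1, (Finset.mem_product.1 (hRC (hF'F he))).1⟩)
      (fun e' => by simp [D]) (hrow _) e he rfl
  · exact key (fun e' => e'.2 = e.2) (Sum.inr ⟨e.2, (Finset.mem_product.1 (hRC (hF'F he))).2⟩)
      (fun e' => by simp [D]) (hcol _) e he rfl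

/-- A bipartite fractional `(2q - 1)`-matching of large weight, where `q` is a prime, contains an
`r`-regular graph in its support, for every positive `r ≤ q`. -/
lemma exists_regular_of_fractional {α : Type*} [Fintype α] [DecidableEq α] {f : α → α → ℝ}
    (hf0 : ∀ a b, 0 ≤ f a b) (hf1 : ∀ a b, f a b ≤ 1) {q r : ℕ} (hq : q.Prime) (hr : 0 < r)
    (hrq : r ≤ q) (hrow : ∀ a, ∑ b, f a b ≤ (2 * q - 1 : ℕ)) (hcol : ∀ b, ∑ a, f a b ≤ (2 * q - 1 : ℕ))
    {R C : Finset α} (hRC : ∀ a b, f a b ≠ 0 → a ∈ R ∧ b ∈ C)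
    (hf : ((q - 1 : ℕ) : ℝ) * (R.card + C.card) < ∑ a, ∑ b, f a b) :
    ∃ F : Finset (α × α), F.Nonempty ∧ (∀ e ∈ F, f e.1 e.2 ≠ 0) ∧
      (∀ e ∈ F, (F.filter fun e' => e'.1 = e.1).card = r) ∧
      ∀ e ∈ F, (F.filter fun e' => e'.2 = e.2).card = r := by
  have hq0 := hq.pos
  obtain ⟨F₁, h1f, h1r, h1c, h1⟩ := exists_integral_matching hf0 hf1 hrow hcol
  obtain ⟨F₂, h21, h2ne, h2r, h2c⟩ := exists_regular_of_prime hq (R := R) (C := C) (F := F₁)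
    (fun e he => Finset.mem_product.2 (hRC _ _ (h1f e he)))
    (fun a => (h1r a).trans_lt (by omega)) (fun b => (h1c b).trans_lt (by omega))
    (by
      have := hf.trans_le h1
      exact_mod_cast this)
  have hqR : (0 : ℝ) < q := by exact_mod_cast hq0
  have hrR : (0 : ℝ) < r := by exact_mod_cast hr
  have hle1 : (r : ℝ) / q ≤ 1 := (div_le_one hqR).2 (by exact_mod_cast hrq)
  -- Every vertex met by F₂ has f₂-degree exactly r.
  set f₂ : α → α → ℝ := fun a b => if (a, b) ∈ F₂ then (r : ℝ) / q else 0 with hf₂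
  have rowcard : ∀ (F : Finset (α × α)) a,
      (Finset.univ.filter fun b => (a, b) ∈ F).card = (F.filter fun e => e.1 = a).card := by
    intro F a
    refine Finset.card_bij (fun b _ => (a, b)) (fun b hb => ?_)
      (fun _ _ _ _ h => (Prod.ext_iff.1 h).2) fun e he => ?_
    · simpa using hb
    · obtain ⟨a', b⟩ := e
      simp only [Finset.mem_filter] at he
      obtain ⟨he, rfl⟩ := he
      exact ⟨b, by simpa using he, rfl⟩
  have colcard : ∀ (F : Finset (α × α)) b,
      (Finset.univ.filter fun a => (a, b) ∈ F).card = (F.filter fun e => e.2 = b).card := by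
    intro F b
    refine Finset.card_bij (fun a _ => (a, b)) (fun a ha => ?_)
      (fun _ _ _ _ h => (Prod.ext_iff.1 h).1) fun e he => ?_
    · simpa using ha
    · obtain ⟨a, b'⟩ := e
      simp only [Finset.mem_filter] at he
      obtain ⟨he, rfl⟩ := he
      exact ⟨a, by simpa using he, rfl⟩
  have rowsum : ∀ a, ∑ b, f₂ a b = (F₂.filter fun e => e.1 = a).card * ((r : ℝ) / q) := fun a => by
    rw [← rowcard, ← Finset.sum_filter, Finset.sum_const, nsmul_eq_mul]
  have colsum : ∀ b, ∑ a, f₂ a b = (F₂.filter fun e => e.2 = b).card * ((r : ℝ) / q) := fun b => by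
    rw [← colcard, ← Finset.sum_filter, Finset.sum_const, nsmul_eq_mul]
  have rowq : ∀ a, (F₂.filter fun e => e.1 = a).card ≤ q := fun a => by
    rcases (F₂.filter fun e => e.1 = a).eq_empty_or_nonempty with h | ⟨e, he⟩
    · simp [h]
    · obtain ⟨he', rfl⟩ := Finset.mem_filter.1 he
      exact (h2r e he').le
  have colq : ∀ b, (F₂.filter fun e => e.2 = b).card ≤ q := fun b => by
    rcases (F₂.filter fun e => e.2 = b).eq_empty_or_nonempty with h | ⟨e, he⟩
    · simp [h]
    · obtain ⟨he', rfl⟩ := Finset.mem_filter.1 he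
      exact (h2c e he').le
  have bound : ∀ n : ℕ, n ≤ q → (n : ℝ) * ((r : ℝ) / q) ≤ r := fun n hn => by
    have : (n : ℝ) ≤ q := by exact_mod_cast hn
    calc (n : ℝ) * ((r : ℝ) / q) ≤ q * ((r : ℝ) / q) :=
          mul_le_mul_of_nonneg_right this (by positivity)
      _ = r := mul_div_cancel₀ _ hqR.ne'
  obtain ⟨F, h3f, h3r, h3c, h3⟩ := exists_integral_matching (f := f₂) (k := r)
    (fun a b => ite_nonneg (by positivity) le_rfl)
    (fun a b => by
      simp only [hf₂]
      split_ifs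
      exacts [hle1, zero_le_one])
    (fun a => (rowsum a).trans_le (bound _ (rowq a)))
    (fun b => (colsum b).trans_le (bound _ (colq b)))
  have hFF₂ : F ⊆ F₂ := fun e he => by
    by_contra h
    exact h3f e he (if_neg h)
  have cardrow : ∀ F : Finset (α × α), (F.card : ℝ) = ∑ a, ((F.filter fun e => e.1 = a).card : ℝ) := by
    intro F
    rw [Finset.card_eq_sum_card_fiberwise (t := Finset.univ) (f := Prod.fst) (fun e _ => Finset.mem_coe.2 (Finset.mem_univ _)),
      Nat.cast_sum]
  have cardcol : ∀ F : Finset (α × α), (F.card : ℝ) = ∑ b, ((F.filter fun e => e.2 = b).card : ℝ) := by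
    intro F
    rw [Finset.card_eq_sum_card_fiberwise (t := Finset.univ) (f := Prod.snd) (fun e _ => Finset.mem_coe.2 (Finset.mem_univ _)),
      Nat.cast_sum]
  have tight : ∀ n k : ℕ, (n = 0 ∨ k = q) → n ≤ r → (n : ℝ) ≤ k * ((r : ℝ) / q) := by
    rintro n k (rfl | rfl) h
    · rw [Nat.cast_zero]; positivity
    · rw [mul_div_cancel₀ _ hqR.ne']; exact_mod_cast h
  have empty : ∀ (s : α × α → Prop) [DecidablePred s], (∀ e ∈ F₂, s e → (F₂.filter s).card = q) →
      (F.filter s).card = 0 ∨ (F₂.filter s).card = q := by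
    intro s _ hs
    rcases (F.filter s).eq_empty_or_nonempty with h | ⟨e, he⟩
    · exact Or.inl (by rw [h, Finset.card_empty])
    · obtain ⟨he, hse⟩ := Finset.mem_filter.1 he
      exact Or.inr (hs e (hFF₂ he) hse)
  have hrq' : (q : ℝ) * ((r : ℝ) / q) = r := mul_div_cancel₀ _ hqR.ne'
  have lerow : ∀ a ∈ Finset.univ, ((F.filter fun e => e.1 = a).card : ℝ) ≤ ∑ b, f₂ a b := fun a _ => by
    rw [rowsum]
    exact tight _ _ (empty (fun e => e.1 = a) fun e he h => h ▸ h2r e he) (h3r a)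
  have lecol : ∀ b ∈ Finset.univ, ((F.filter fun e => e.2 = b).card : ℝ) ≤ ∑ a, f₂ a b := fun b _ => by
    rw [colsum]
    exact tight _ _ (empty (fun e => e.2 = b) fun e he h => h ▸ h2c e he) (h3c b)
  -- F has at least the total weight of f₂ but at most its weight in each row and column, hence
  -- equality everywhere.
  have eqrow := (Finset.sum_eq_sum_iff_of_le lerow).1
    (le_antisymm (Finset.sum_le_sum lerow) (h3.trans_eq (cardrow F)))
  have eqcol := (Finset.sum_eq_sum_iff_of_le lecol).1
    (le_antisymm (Finset.sum_le_sum lecol) ((Finset.sum_comm.trans_le h3).trans_eq (cardcol F)))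
  refine ⟨F, ?_, fun e he => h1f e (h21 (hFF₂ he)), fun e he => ?_, fun e he => ?_⟩
  · rw [← Finset.card_pos]
    have : ∑ a, ∑ b, f₂ a b = F₂.card * ((r : ℝ) / q) := by
      rw [cardrow F₂, Finset.sum_mul]
      exact Finset.sum_congr rfl fun a _ => rowsum a
    rw [this] at h3
    have h2 : (0 : ℝ) < F₂.card := by exact_mod_cast h2ne.card_pos
    have : (0 : ℝ) < F.card := (mul_pos h2 (div_pos hrR hqR)).trans_le h3
    exact_mod_cast this
  · have := eqrow e.1 (Finset.mem_univ _)
    rw [rowsum, h2r e (hFF₂ he), hrq'] at this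
    exact_mod_cast this
  · have := eqcol e.2 (Finset.mem_univ _)
    rw [colsum, h2c e (hFF₂ he), hrq'] at this
    exact_mod_cast this

/-! ### From nearly regular weightings to regular subgraphs. -/

namespace SimpleGraph

variable {V : Type*} [Fintype V] {G : SimpleGraph V}

open Classical in
lemma hasRegularSubgraph_of_finset {A B : Finset V} (hAB : Disjoint A B) {F : Finset (V × V)}
    (hF : F.Nonempty) (hFG : ∀ e ∈ F, G.Adj e.1 e.2 ∧ e.1 ∈ A ∧ e.2 ∈ B) {r : ℕ}
    (hrow : ∀ e ∈ F, (F.filter fun e' => e'.1 = e.1).card = r)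
    (hcol : ∀ e ∈ F, (F.filter fun e' => e'.2 = e.2).card = r) : G.HasRegularSubgraph r := by
  have hnB : ∀ {v}, v ∈ A → v ∉ B := fun h h' => Finset.disjoint_left.1 hAB h h'
  let H : G.Subgraph :=
    { verts := {v | ∃ w, (v, w) ∈ F ∨ (w, v) ∈ F}
      Adj := fun v w => (v, w) ∈ F ∨ (w, v) ∈ F
      adj_sub := fun {v w} h => h.elim (fun h => (hFG _ h).1) fun h => (hFG _ h).1.symm
      edge_vert := fun {v w} h => ⟨w, h⟩
      symm := ⟨fun v w h => h.symm⟩ }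
  refine ⟨H, ?_, fun v => ?_⟩
  · obtain ⟨e, he⟩ := hF
    exact ⟨e.1, e.2, Or.inl he⟩
  · rw [Subgraph.coe_degree, ← Subgraph.finset_card_neighborSet_eq_degree]
    obtain ⟨v, w, h | h⟩ := v
    · rw [← hrow _ h]
      refine Finset.card_bij (fun u _ => (v, u)) (fun u hu => ?_)
        (fun _ _ _ _ h => (Prod.ext_iff.1 h).2) fun e he => ?_
      · have hu : (v, u) ∈ F ∨ (u, v) ∈ F := by simpa using hu
        refine Finset.mem_filter.2 ⟨hu.resolve_right fun h' => ?_, rfl⟩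
        exact hnB (hFG _ h).2.1 (hFG _ h').2.2
      · obtain ⟨v', u⟩ := e
        obtain ⟨he', rfl⟩ := Finset.mem_filter.1 he
        exact ⟨u, by simpa using (Or.inl he' : (v', u) ∈ F ∨ (u, v') ∈ F), rfl⟩
    · rw [← hcol _ h]
      refine Finset.card_bij (fun u _ => (u, v)) (fun u hu => ?_)
        (fun _ _ _ _ h => (Prod.ext_iff.1 h).1) fun e he => ?_
      · have hu : (v, u) ∈ F ∨ (u, v) ∈ F := by simpa using hu
        refine Finset.mem_filter.2 ⟨hu.resolve_left fun h' => ?_, rfl⟩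
        exact hnB (hFG _ h').2.1 (hFG _ h).2.2
      · obtain ⟨u, v'⟩ := e
        obtain ⟨he', rfl⟩ := Finset.mem_filter.1 he
        exact ⟨u, by simpa using (Or.inr he' : (v', u) ∈ F ∨ (u, v') ∈ F), rfl⟩

lemma hasRegularSubgraph_zero [Nonempty V] : G.HasRegularSubgraph 0 := by
  classical
  let v : V := Classical.arbitrary V
  refine ⟨G.singletonSubgraph v, ⟨v, rfl⟩, fun w => ?_⟩
  rw [Subgraph.coe_degree]
  exact Subgraph.degree_eq_zero_of_subsingleton _ _ Set.subsingleton_singleton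

/-- A nearly regular weighting of a bipartite graph yields regular subgraphs. -/
lemma HasNearRegularWeight.hasRegularSubgraph {A B : Finset V} (hG : G.IsBipartiteWith A B)
    (hAB : ∀ v, v ∈ A ∨ v ∈ B) {T Λ η : ℝ} (h : G.HasNearRegularWeight T Λ η) {r : ℕ} (hr : 0 < r)
    (hΛ : 0 ≤ Λ) (hη : 0 ≤ η) (hT : 4 * r * (Λ + η) ≤ T) (hT1 : 4 * r ≤ T) :
    G.HasRegularSubgraph r := by
  classical
  obtain ⟨U, h, hU, hw, hdev⟩ := h
  obtain ⟨q, hq, hrq, hq2⟩ := Nat.exists_prime_lt_and_le_two_mul r hr.ne'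
  have hr0 : (0 : ℝ) < r := by exact_mod_cast hr
  have hT0 : 0 < T := by linarith
  have hUc : (0 : ℝ) < U.card := by exact_mod_cast hU.card_pos
  set ρ : ℝ := ((2 * q - 1 : ℕ) : ℝ) with hρ
  have hρq : ρ = 2 * q - 1 := by
    rw [hρ, Nat.cast_sub (by omega)]; push_cast; ring
  have hq1 : ((q - 1 : ℕ) : ℝ) = q - 1 := by
    rw [Nat.cast_sub (by omega)]; push_cast; ring
  have hq2' : (q : ℝ) ≤ 2 * r := by exact_mod_cast hq2
  have hq0 : (1 : ℝ) ≤ q := by exact_mod_cast hq.one_le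
  have hρ0 : 0 < ρ := by linarith
  have hρT : ρ ≤ T := by linarith
  have hdisj : Disjoint A B := Finset.disjoint_coe.1 hG.disjoint
  set d : V → ℝ := fun v => ∑ w ∈ U, h v w with hd
  have hd0 : ∀ v, 0 ≤ d v := fun v => Finset.sum_nonneg fun w _ => hw.nonneg v w
  set D : V → ℝ := fun v => max T (d v) with hD
  have hDT : ∀ v, T ≤ D v := fun v => le_max_left _ _
  have hDd : ∀ v, d v ≤ D v := fun v => le_max_right _ _
  have hD0 : ∀ v, 0 < D v := fun v => hT0.trans_le (hDT v)
  -- the truncated weighting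
  set φ : V → V → ℝ := fun v w => ρ * T * h v w / (D v * D w) with hφ
  have hφ0 : ∀ v w, 0 ≤ φ v w := fun v w =>
    div_nonneg (mul_nonneg (mul_nonneg hρ0.le hT0.le) (hw.nonneg v w))
      (mul_nonneg (hD0 v).le (hD0 w).le)
  have hφsymm : ∀ v w, φ v w = φ w v := fun v w => by
    simp only [hφ]
    rw [hw.symm v w, mul_comm (D v)]
  have hφle : ∀ v w, φ v w ≤ ρ * h v w / D v := fun v w => by
    rw [div_le_div_iff₀ (mul_pos (hD0 v) (hD0 w)) (hD0 v)]
    have := mul_le_mul_of_nonneg_left (hDT w)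
      (mul_nonneg (mul_nonneg hρ0.le (hw.nonneg v w)) (hD0 v).le)
    linarith
  have hφrow : ∀ v, ∑ w ∈ U, φ v w ≤ ρ := fun v => by
    refine (Finset.sum_le_sum fun w _ => hφle v w).trans ?_
    rw [← Finset.sum_div, ← Finset.mul_sum, div_le_iff₀ (hD0 v)]
    exact mul_le_mul_of_nonneg_left (hDd v) hρ0.le
  have hφ1 : ∀ v w, φ v w ≤ 1 := fun v w => by
    refine (hφle v w).trans ?_
    rw [div_le_one (hD0 v)]
    have := mul_le_of_le_one_right hρ0.le (hw.le_one v w)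
    linarith [hDT v]
  -- This is (1 - a)(1 - b) ≥ 1 - a - b with 1 - a = T / D v and 1 - b = T / D w.
  have hφge : ∀ v w, ρ / T * (h v w - h v w * ((D v - T) / D v) - h v w * ((D w - T) / D w)) ≤
      φ v w := fun v w => by
    have e : φ v w - ρ / T * (h v w - h v w * ((D v - T) / D v) - h v w * ((D w - T) / D w)) =
        ρ / T * h v w * (((D v - T) / D v) * ((D w - T) / D w)) := by
      have h1 := (hD0 v).ne'
      have h2 := (hD0 w).ne'
      simp only [hφ]
      field_simp
      ring
    have : 0 ≤ ρ / T * h v w * (((D v - T) / D v) * ((D w - T) / D w)) :=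
      mul_nonneg (mul_nonneg (div_nonneg hρ0.le hT0.le) (hw.nonneg v w))
        (mul_nonneg (div_nonneg (sub_nonneg.2 (hDT v)) (hD0 v).le)
          (div_nonneg (sub_nonneg.2 (hDT w)) (hD0 w).le))
    linarith
  have hloss : ∀ v, d v * ((D v - T) / D v) ≤ D v - T := fun v => by
    rw [← mul_div_assoc, div_le_iff₀ (hD0 v), mul_comm]
    exact mul_le_mul_of_nonneg_left (hDd v) (sub_nonneg.2 (hDT v))
  have habs : ∀ v, d v - 2 * (D v - T) = T - |d v - T| := fun v => by
    rcases le_total T (d v) with h' | h'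
    · simp only [hD]
      rw [max_eq_right h', abs_of_nonneg (sub_nonneg.2 h')]; ring
    · simp only [hD]
      rw [max_eq_left h', abs_of_nonpos (sub_nonpos.2 h')]; ring
  have hdevsum : ∑ v ∈ U, |d v - T| ≤ (Λ + η) * U.card := by
    have : ∀ v ∈ U, |d v - T| ≤ Λ + max (|d v - T| - Λ) 0 := fun v _ => by
      linarith [le_max_left (|d v - T| - Λ) 0]
    refine (Finset.sum_le_sum this).trans ?_
    rw [Finset.sum_add_distrib, Finset.sum_const, nsmul_eq_mul]
    linarith
  have htot : ρ * U.card - ρ / T * ((Λ + η) * U.card) ≤ ∑ v ∈ U, ∑ w ∈ U, φ v w := by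
    refine le_trans ?_ (Finset.sum_le_sum fun v _ => Finset.sum_le_sum fun w _ => hφge v w)
    have e : ∑ v ∈ U, ∑ w ∈ U, ρ / T *
        (h v w - h v w * ((D v - T) / D v) - h v w * ((D w - T) / D w)) =
        ρ / T * (∑ v ∈ U, d v - 2 * ∑ v ∈ U, d v * ((D v - T) / D v)) := by
      simp only [← Finset.mul_sum, Finset.sum_sub_distrib, ← Finset.sum_mul]
      rw [Finset.sum_comm (f := fun v w => h v w * ((D w - T) / D w))]
      simp only [← Finset.sum_mul, fun v w => hw.symm w v]
      congr 1
      ring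
    rw [e, show ρ * U.card - ρ / T * ((Λ + η) * U.card) =
      ρ / T * (T * U.card - (Λ + η) * U.card) by field_simp]
    refine mul_le_mul_of_nonneg_left ?_ (div_nonneg hρ0.le hT0.le)
    have h1 : ∑ v ∈ U, (d v - 2 * (D v - T)) = T * U.card - ∑ v ∈ U, |d v - T| := by
      simp only [habs, Finset.sum_sub_distrib, Finset.sum_const, nsmul_eq_mul]
      ring
    have h2 := Finset.sum_le_sum fun v (_ : v ∈ U) => hloss v
    rw [Finset.sum_sub_distrib, ← Finset.mul_sum] at h1
    linarith
  set f : V → V → ℝ := fun v w => if v ∈ A ∩ U ∧ w ∈ B ∩ U then φ v w else 0 with hf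
  have hf0 : ∀ v w, 0 ≤ f v w := fun v w => ite_nonneg (hφ0 v w) le_rfl
  have hfφ : ∀ v w, f v w ≤ if w ∈ U then φ v w else 0 := fun v w => by
    by_cases hvw : v ∈ A ∩ U ∧ w ∈ B ∩ U
    · rw [if_pos (Finset.mem_inter.1 hvw.2).2]
      exact (if_pos hvw).le
    · exact (if_neg hvw).trans_le (ite_nonneg (hφ0 v w) le_rfl)
  have hfφ' : ∀ v w, f v w ≤ if v ∈ U then φ w v else 0 := fun v w => by
    by_cases hvw : v ∈ A ∩ U ∧ w ∈ B ∩ U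
    · rw [if_pos (Finset.mem_inter.1 hvw.1).2, hφsymm]
      exact (if_pos hvw).le
    · exact (if_neg hvw).trans_le (ite_nonneg (hφ0 w v) le_rfl)
  have hsum : ∀ g : V → ℝ, (∑ w, if w ∈ U then g w else 0) = ∑ w ∈ U, g w := fun g => by
    rw [Finset.sum_ite_mem, Finset.univ_inter]
  have hfsum : ∑ v ∈ U, ∑ w ∈ U, φ v w = 2 * ∑ v, ∑ w, f v w := by
    have e : ∀ v w, (if v ∈ U then if w ∈ U then φ v w else 0 else 0) = f v w + f w v := by
      intro v w
      by_cases hadj : φ v w = 0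
      · have h' : φ w v = 0 := by rw [hφsymm, hadj]
        simp [hf, hadj, h']
      · have hvw : G.Adj v w := by
          refine hw.adj v w fun h0 => hadj ?_
          simp [hφ, h0]
        by_cases hv : v ∈ U <;> by_cases hwU : w ∈ U
        · rcases hG.mem_of_adj hvw with ⟨h1, h2⟩ | ⟨h1, h2⟩
          · have h1' : v ∈ A := h1
            have h2' : w ∈ B := h2
            have h3 : w ∉ A := Finset.disjoint_right.1 hdisj h2
            simp [hf, hv, hwU, h1', h2', h3]
          · have h1' : v ∈ B := h1
            have h2' : w ∈ A := h2
            have h3 : v ∉ A := Finset.disjoint_right.1 hdisj h1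
            simp [hf, hv, hwU, h1', h2', h3, hφsymm w v]
        all_goals simp [hf, hv, hwU]
    have : ∑ v, ∑ w, (if v ∈ U then if w ∈ U then φ v w else 0 else 0) =
        ∑ v ∈ U, ∑ w ∈ U, φ v w := by
      rw [← hsum]
      refine Finset.sum_congr rfl fun v _ => ?_
      split_ifs
      · exact hsum _
      · exact Finset.sum_const_zero
    rw [← this]
    simp only [e, Finset.sum_add_distrib]
    rw [Finset.sum_comm (f := fun v w => f w v), two_mul]
  have hcardU : ((A ∩ U).card : ℝ) + (B ∩ U).card = U.card := by
    rw [← Nat.cast_add, ← Finset.card_union_of_disjoint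
      (hdisj.mono Finset.inter_subset_left Finset.inter_subset_left), ← Finset.union_inter_distrib_right]
    congr 2
    exact Finset.inter_eq_right.2 fun v _ => Finset.mem_union.2 (hAB v)
  obtain ⟨F, hF, hFf, hFr, hFc⟩ := exists_regular_of_fractional (f := f) (R := A ∩ U) (C := B ∩ U)
    hf0 (fun v w => (hfφ v w).trans (by split_ifs; exacts [hφ1 v w, zero_le_one])) hq hr hrq.le
    (fun v => by
      refine (Finset.sum_le_sum fun w _ => hfφ v w).trans ?_
      rw [hsum]
      exact hφrow v)
    (fun w => by
      refine (Finset.sum_le_sum fun v _ => hfφ' v w).trans ?_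
      rw [hsum]
      exact hφrow w)
    (fun v w hne => (ite_ne_right_iff.1 hne).1)
    (by
      rw [hcardU, hq1]
      -- Since ρ = 2(q - 1) + 1, truncation may cost anything below 1 per vertex; q ≤ 2r gives ρ <
      -- 4r, whence the hypothesis on T.
      have h1 : ρ / T * ((Λ + η) * U.card) < U.card := by
        rw [← mul_assoc, div_mul_eq_mul_div]
        refine mul_lt_of_lt_one_left hUc ((div_lt_one hT0).2 ?_)
        rcases (add_nonneg hΛ hη).eq_or_lt with h0 | h0
        · rw [← h0, mul_zero]; exact hT0
        · refine lt_of_lt_of_le (mul_lt_mul_of_pos_right ?_ h0) hT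
          linarith
      rw [hρq] at htot h1
      rw [hfsum] at htot
      nlinarith)
  refine hasRegularSubgraph_of_finset hdisj hF (fun e he => ?_) hFr hFc
  obtain ⟨⟨h1, h2⟩, h3⟩ := ite_ne_right_iff.1 (hFf e he)
  refine ⟨hw.adj _ _ fun h0 => h3 ?_, (Finset.mem_inter.1 h1).1, (Finset.mem_inter.1 h2).1⟩
  simp [hφ, h0]

end SimpleGraph

/-! ### Choice of parameters. -/

namespace SimpleGraph

variable {V : Type*} [Fintype V] {G : SimpleGraph V} {A B : Finset V}

lemma IsAlmostBiregular.exists_hasNearRegularWeight [DecidableRel G.Adj] {L : ℝ} {s : ℕ}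
    (hG : G.IsAlmostBiregular A B L s) (hs : 2 ≤ s) (hsL : (s : ℝ) ≤ L)
    (hL : 4000000 ≤ (s : ℝ) / (6 * Real.logb 2 L)) :
    ∃ T, (s : ℝ) / (6 * Real.logb 2 L) ≤ T ∧ G.HasNearRegularWeight T (T / 100) (1 / 2) := by
  classical
  have hs2 : (2 : ℝ) ≤ s := by exact_mod_cast hs
  have hL2 : 2 ≤ L := hs2.trans hsL
  have hL0 : 0 < L := by linarith
  set l := Real.logb 2 L with hl
  have hl1 : 1 ≤ l := (Real.le_logb_iff_rpow_le one_lt_two hL0).2 (by rwa [Real.rpow_one])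
  -- This gives 2^m ≥ L² ≥ L s, as the density condition requires, and 2m ≤ 4l + 2 ≤ 6l, the source
  -- of the factor 6.
  set m := ⌈2 * l⌉₊ with hm
  have hm1 : 2 * l ≤ m := Nat.le_ceil _
  have hm2 : (m : ℝ) < 2 * l + 1 := Nat.ceil_lt_add_one (by linarith)
  have hm0 : (0 : ℝ) < m := by linarith
  have hLm : L * s ≤ 2 ^ m := by
    have h1 : L ^ 2 = (2 : ℝ) ^ (2 * l) := by
      rw [mul_comm, Real.rpow_mul zero_le_two, hl, Real.rpow_logb two_pos (by norm_num) hL0]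
      exact (Real.rpow_natCast L 2).symm
    have h2 : (2 : ℝ) ^ (2 * l) ≤ 2 ^ (m : ℝ) := Real.rpow_le_rpow_of_exponent_le one_le_two hm1
    rw [Real.rpow_natCast] at h2
    nlinarith
  have hT : (s : ℝ) / (6 * l) ≤ s / (2 * m) :=
    div_le_div_of_nonneg_left (by linarith) (by linarith) (by linarith)
  have hbip := hG.isBipartiteWith
  have hA : A.Nonempty := by
    rw [Finset.nonempty_iff_ne_empty]
    rintro rfl
    have := hG.le_average
    rw [Finset.card_empty, Nat.cast_zero, div_zero] at this
    linarith
  have hA0 : (0 : ℝ) < A.card := by exact_mod_cast hA.card_pos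
  have hedges : (G.edgeFinset.card : ℝ) = B.card * s := by
    rw [← isBipartiteWith_sum_degrees_eq_card_edges' hbip, Finset.sum_congr rfl hG.degree_right,
      Finset.sum_const, smul_eq_mul, Nat.cast_mul]
  have havg := hG.le_average
  have hdeg := hG.degree_left
  rw [hedges] at havg hdeg
  refine ⟨_, hT, hasNearRegularWeight_of_density (m := m) (Finset.disjoint_coe.1 hbip.disjoint) hA
    (by exact_mod_cast hm0.ne') (by omega) (hL.trans hT) (D := L * (B.card * s / A.card))
    (fun y hy => ?_) (fun x hx => ?_) ?_ ?_⟩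
  · rw [← hG.degree_right y hy, ← card_neighborFinset_eq_degree,
      isBipartiteWith_neighborFinset' hbip hy]
    simp only [G.adj_comm]
  · rw [← isBipartiteWith_neighborFinset hbip hx, card_neighborFinset_eq_degree]
    exact hdeg x hx
  · rw [le_div_iff₀ hA0, mul_comm] at havg
    exact mul_le_mul_of_nonneg_left (le_of_mul_le_mul_right havg (by linarith)) (by positivity)
  · have e : L * (B.card * s / A.card) * ((s : ℝ) / 2) ^ m * A.card =
        (s : ℝ) ^ m * B.card * (L * s / 2 ^ m) := by
      rw [div_pow]
      field_simp
    rw [e]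
    exact mul_le_of_le_one_right (by positivity) ((div_le_one (by positivity)).2 hLm)

/-- Halving stops once Λ lies in [16000, 32000), when T' is still at least T/2. As η ≤ 2, the
rounding condition holds because 4 · 32002 is below 2000000. -/
lemma HasNearRegularWeight.hasRegularSubgraph_of_le (hG : G.IsBipartiteWith A B)
    (hAB : ∀ v, v ∈ A ∨ v ∈ B) {T : ℝ} {r : ℕ} (hr : 0 < r) (hT : 4000000 * r ≤ T)
    (h : G.HasNearRegularWeight T (T / 100) (1 / 2)) : G.HasRegularSubgraph r := by
  have hr1 : (1 : ℝ) ≤ r := by exact_mod_cast hr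
  have hex : ∃ j : ℕ, T / 100 / 2 ^ (j + 1) < 16000 := by
    obtain ⟨j, hj⟩ := pow_unbounded_of_one_lt (T / 100) (one_lt_two (α := ℝ))
    refine ⟨j, ?_⟩
    rw [div_lt_iff₀ (by positivity), pow_succ]
    have : (0 : ℝ) < 2 ^ j := by positivity
    linarith
  obtain ⟨j, hj1, hj2⟩ : ∃ j : ℕ, 16000 ≤ T / 100 / 2 ^ j ∧ T / 100 / 2 ^ (j + 1) < 16000 := by
    classical
    refine ⟨Nat.find hex, ?_, Nat.find_spec hex⟩
    rcases hn : Nat.find hex with _ | n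
    · rw [pow_zero, div_one]; linarith
    · exact not_lt.1 (Nat.find_min hex (m := n) (by omega))
  obtain ⟨T', hT', h'⟩ := h.iterate_halve (by linarith) j hj1
  set Λ := T / 100 / 2 ^ j with hΛ
  have hΛ2 : Λ < 32000 := by
    rw [pow_succ, ← div_div, ← hΛ] at hj2
    linarith
  have hΛT : Λ ≤ T / 100 := div_le_self (by linarith) (one_le_pow₀ one_le_two)
  have h1 : 28 * Λ / T ≤ 1 := by
    rw [div_le_one (by linarith)]
    linarith
  have h2 : 0 ≤ 28 * Λ / T := div_nonneg (by linarith) (by linarith)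
  have h3 : 0 ≤ 1 / Λ := div_nonneg zero_le_one (by linarith)
  have h4 : 1 / Λ ≤ 1 := (div_le_one (by linarith)).2 (by linarith)
  refine h'.hasRegularSubgraph hG hAB hr (by linarith) (by linarith) ?_ (by linarith)
  have : 4 * r * (Λ + (1 - 28 * Λ / T + 1 / Λ)) ≤ 4 * r * 32002 :=
    mul_le_mul_of_nonneg_left (by linarith) (by positivity)
  linarith

end SimpleGraph

theorem lemma3p3 :
    ∃ c : ℝ, 0 < c ∧
      ∀ (V : Type*) [Fintype V] [Nonempty V] (G : SimpleGraph V) [DecidableRel G.Adj]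
        (A B : Finset V) (L : ℝ) (s : ℕ),
        2 ≤ s → (s : ℝ) ≤ L → G.IsAlmostBiregular A B L s →
          ∀ r : ℕ, (r : ℝ) ≤ c * (s : ℝ) / Real.logb 2 L → G.HasRegularSubgraph r := by
  -- The constant is 1 / (6 · 4000000). The case r = 0 is separate, since r ≥ 1 is what makes T at
  -- least 4000000.
  refine ⟨1 / 24000000, by norm_num, fun V _ _ G _ A B L s hs hsL hG r hr => ?_⟩
  rcases Nat.eq_zero_or_pos r with rfl | hr0
  · exact SimpleGraph.hasRegularSubgraph_zero
  have hr1 : (1 : ℝ) ≤ r := by exact_mod_cast hr0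
  have hrT : 4000000 * (r : ℝ) ≤ s / (6 * Real.logb 2 L) := by
    rw [show (s : ℝ) / (6 * Real.logb 2 L) =
      4000000 * (1 / 24000000 * (s : ℝ) / Real.logb 2 L) by ring]
    linarith
  obtain ⟨T, hT, h⟩ := hG.exists_hasNearRegularWeight hs hsL (by linarith)
  exact h.hasRegularSubgraph_of_le hG.isBipartiteWith hG.mem_or_mem hr0 (hrT.trans hT)
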